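/- Let $\Gamma$ be a finitely generated group and let $\mu\colon\Gamma\times\Gamma\to[0,\infty)$ be a random walk on $\Gamma$ that is $\Gamma$-invariant ($\mu(\gamma\gamma',\gamma\gamma'')=\mu(\gamma',\gamma'')$), finitely supported (for each $\gamma$, $\mu(\gamma,\gamma')=0$ for all but finitely many $\gamma'$), normalized ($\sum_{\gamma'}\mu(\gamma,\gamma')=1$ for each $\gamma$), symmetric ($\mu(\gamma,\gamma')=\mu(\gamma',\gamma)$) and irreducible (any two $\gamma,\gamma'$ are joined by a finite chain $\gamma=\gamma_0,\dots,\gamma_k=\gamma'$ with $\mu(\gamma_i,\gamma_{i+1})\neq 0$). Let $Y$ be a nonempty complete $\mathrm{CAT}(0)$ space with metric $d$ and $\rho\colon\Gamma\to\mathrm{Isom}(Y)$ a homomorphism. A map $f\colon\Gamma\to Y$ is $\rho$-equivariant if $f(\gamma\gamma')=\rho(\gamma)f(\gamma')$ for all $\gamma,\gamma'\in\Gamma$. Let $\mu^n$ be the $n$-fold convolution of $\mu$, $\mu^n(\gamma,\gamma')=\sum_{\gamma_1,\dots,\gamma_{n-1}}\mu(\gamma,\gamma_1)\cdots\mu(\gamma_{n-1},\gamma')$,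 and for a $\rho$-equivariant $f$ put $$E_{\mu^n}(f)=\frac12\sum_{\gamma\in\Gamma}\mu^n(e,\gamma)\,d(f(e),f(\gamma))^2 .$$ For $p\in Y$, let the space of directions $S_pY$ be the metric completion of the set of nontrivial geodesics starting at $p$, modulo angle $0$, with respect to the angle $\angle_p$. Let the tangent cone $TC_pY$ be the cone over $S_pY$, with points $(u,t)$, $u\in S_pY$, $t\ge 0$, all $(u,0)$ being identified with the cone point $0_p$ (and $TC_pY=\{0_p\}$ if $S_pY=\emptyset$), with the metric given by $d((u,t),(u',t'))^2=t^2+t'^2-2tt'\cos\angle_p(u,u')$, and write $|(u,t)|=t$. Let $\pi_p\colon Y\to TC_pY$ send $p$ to $0_p$ and send $q\neq p$ to $(u,d(p,q))$, where $u$ is the direction of the geodesic from $p$ to $q$. Let $-\Delta_\mu f(e)\in TC_{f(e)}Y$ be the barycenter of the push-forward of $\mu(e,\cdot)$ under $\gamma\mapsto\pi_{f(e)}(f(\gamma))$, that is, the unique minimizer of $q\mapsto\sum_{\gamma}\mu(e,\gamma)\,d(\pi_{f(e)}(f(\gamma)),q)^2$ on $TC_{f(e)}Y$. Suppose that there exist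 a positive integer $n$ and a real number $\varepsilon>0$ such that $$E_{\mu^n}(f)\le(n-\varepsilon)\,E_\mu(f)$$ for every $\rho$-equivariant map $f\colon\Gamma\to Y$. Then there exists a constant $C>0$ such that, for every $\rho$-equivariant map $f\colon\Gamma\to Y$, the barycenter $-\Delta_\mu f(e)$ exists and $$|-\Delta_\mu f(e)|^2\ge C\,E_\mu(f).$$ Moreover, $\rho(\Gamma)$ has a global fixed point: there is $p\in Y$ with $\rho(\gamma)p=p$ for all $\gamma\in\Gamma$. -/

import Mathlib

open Filter Topology

/-! ### CAT(0) spaces -/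

/-- `c`, restricted to `[0, d(p,q)]`, is a unit speed geodesic joining `p` to `q`. -/
def IsUnitSpeedGeodesic {Y : Type*} [MetricSpace Y] (c : ℝ → Y) (p q : Y) : Prop :=
  c 0 = p ∧ c (dist p q) = q ∧
    ∀ s ∈ Set.Icc 0 (dist p q), ∀ t ∈ Set.Icc 0 (dist p q), dist (c s) (c t) = |s - t|

/-- A CAT(0) space: a geodesic space all of whose geodesic triangles satisfy the CAT(0)
comparison condition. The condition is written for two points `c s`, `c' t` on the two sides
of a triangle `p, q, r` that issue from the vertex `p`; as the labelling of the vertices is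
arbitrary, this covers every pair of sides. The points `x`, `y` are the comparison points on the
sides of the comparison triangle `p', q', r'`. -/
class CAT0Space (Y : Type*) [MetricSpace Y] : Prop where
  exists_geodesic : ∀ p q : Y, ∃ c : ℝ → Y, IsUnitSpeedGeodesic c p q
  comparison : ∀ (p q r : Y) (c c' : ℝ → Y),
    IsUnitSpeedGeodesic c p q → IsUnitSpeedGeodesic c' p r →
    ∀ p' q' r' : EuclideanSpace ℝ (Fin 2),
      dist p' q' = dist p q → dist p' r' = dist p r → dist q' r' = dist q r →
      ∀ s ∈ Set.Icc 0 (dist p q), ∀ t ∈ Set.Icc 0 (dist p r),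
      ∀ x ∈ segment ℝ p' q', ∀ y ∈ segment ℝ p' r',
        dist p' x = s → dist p' y = t → dist (c s) (c' t) ≤ dist x y

/-! ### Angles, directions, and the tangent cone -/

/-- The angle at the vertex corresponding to `p` of a comparison triangle for `p, x, y`
(law of cosines). -/
noncomputable def comparisonAngle {Y : Type*} [MetricSpace Y] (p x y : Y) : ℝ :=
  Real.arccos ((dist p x ^ 2 + dist p y ^ 2 - dist x y ^ 2) / (2 * dist p x * dist p y))

/-- A nontrivial geodesic starting from `p`, parametrized by arc length on `[0, length]`. -/
structure NontrivialGeodesic {Y : Type*} [MetricSpace Y] (p : Y) where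
  length : ℝ
  length_pos : 0 < length
  toFun : ℝ → Y
  map_zero : toFun 0 = p
  dist_eq : ∀ s ∈ Set.Icc 0 length, ∀ t ∈ Set.Icc 0 length,
    dist (toFun s) (toFun t) = |s - t|

namespace NontrivialGeodesic

/-- The (Alexandrov) angle between two geodesics starting from `p`. In a CAT(0) space the upper
limit is a limit. -/
noncomputable def angle {Y : Type*} [MetricSpace Y] {p : Y} (c c' : NontrivialGeodesic p) : ℝ :=
  limsup (fun z : ℝ × ℝ => comparisonAngle p (c.toFun z.1) (c'.toFun z.2))
    (𝓝[>] (0 : ℝ) ×ˢ 𝓝[>] (0 : ℝ))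

theorem comparisonAngle_nonneg {Y : Type*} [MetricSpace Y] (p x y : Y) :
    0 ≤ comparisonAngle p x y := Real.arccos_nonneg _

theorem comparisonAngle_le_pi {Y : Type*} [MetricSpace Y] (p x y : Y) :
    comparisonAngle p x y ≤ Real.pi := Real.arccos_le_pi _

theorem isBoundedUnder_le {Y : Type*} [MetricSpace Y] {p : Y} (c c' : NontrivialGeodesic p)
    (l : Filter (ℝ × ℝ)) :
    IsBoundedUnder (· ≤ ·) l
      (fun z : ℝ × ℝ => comparisonAngle p (c.toFun z.1) (c'.toFun z.2)) :=
  isBoundedUnder_of ⟨Real.pi, fun _ => comparisonAngle_le_pi _ _ _⟩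

theorem isBoundedUnder_ge {Y : Type*} [MetricSpace Y] {p : Y} (c c' : NontrivialGeodesic p)
    (l : Filter (ℝ × ℝ)) :
    IsBoundedUnder (· ≥ ·) l
      (fun z : ℝ × ℝ => comparisonAngle p (c.toFun z.1) (c'.toFun z.2)) :=
  isBoundedUnder_of ⟨0, fun _ => comparisonAngle_nonneg _ _ _⟩

theorem dist_base {Y : Type*} [MetricSpace Y] {p : Y} (c : NontrivialGeodesic p) {t : ℝ}
    (h0 : 0 ≤ t) (h1 : t ≤ c.length) : dist p (c.toFun t) = t := by
  have h := c.dist_eq 0 ⟨le_rfl, c.length_pos.le⟩ t ⟨h0, h1⟩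
  rw [c.map_zero] at h
  rw [h, zero_sub, abs_neg, abs_of_nonneg h0]

theorem eventually_small {ε : ℝ} (hε : 0 < ε) :
    ∀ᶠ z : ℝ × ℝ in 𝓝[>] (0 : ℝ) ×ˢ 𝓝[>] (0 : ℝ), (0 < z.1 ∧ z.1 < ε) ∧ 0 < z.2 ∧ z.2 < ε := by
  have h : ∀ᶠ t : ℝ in 𝓝[>] (0 : ℝ), 0 < t ∧ t < ε := Ioo_mem_nhdsGT hε
  exact h.prod_mk h

theorem exists_small {P : ℝ × ℝ → Prop}
    (h : ∀ᶠ z : ℝ × ℝ in 𝓝[>] (0 : ℝ) ×ˢ 𝓝[>] (0 : ℝ), P z) :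
    ∃ ε > 0, ∀ s t : ℝ, 0 < s → s < ε → 0 < t → t < ε → P (s, t) := by
  obtain ⟨pa, ha, pb, hb, hab⟩ := eventually_prod_iff.1 h
  obtain ⟨u, hu, hu'⟩ := mem_nhdsGT_iff_exists_Ioo_subset.1 ha
  obtain ⟨v, hv, hv'⟩ := mem_nhdsGT_iff_exists_Ioo_subset.1 hb
  refine ⟨min u v, lt_min hu hv, fun s t hs hsε ht htε => hab (hu' ⟨hs, ?_⟩) (hv' ⟨ht, ?_⟩)⟩
  · exact hsε.trans_le (min_le_left _ _)
  · exact htε.trans_le (min_le_right _ _)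

theorem angle_self {Y : Type*} [MetricSpace Y] {p : Y} (c : NontrivialGeodesic p) :
    angle c c = 0 := by
  have h : (fun z : ℝ × ℝ => comparisonAngle p (c.toFun z.1) (c.toFun z.2))
      =ᶠ[𝓝[>] (0 : ℝ) ×ˢ 𝓝[>] (0 : ℝ)] fun _ => (0 : ℝ) := by
    filter_upwards [eventually_small c.length_pos] with z hz
    obtain ⟨⟨h1, h2⟩, h3, h4⟩ := hz
    have e : (z.1 ^ 2 + z.2 ^ 2 - |z.1 - z.2| ^ 2) / (2 * z.1 * z.2) = 1 := by
      rw [sq_abs]; field_simp; ring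
    rw [comparisonAngle, c.dist_base h1.le h2.le, c.dist_base h3.le h4.le,
      c.dist_eq _ ⟨h1.le, h2.le⟩ _ ⟨h3.le, h4.le⟩, e, Real.arccos_one]
  rw [angle, limsup_congr h, limsup_const]

theorem angle_comm {Y : Type*} [MetricSpace Y] {p : Y} (c c' : NontrivialGeodesic p) :
    angle c c' = angle c' c := by
  have key : ∀ x y : Y, comparisonAngle p x y = comparisonAngle p y x := fun x y => by
    unfold comparisonAngle
    rw [dist_comm x y]; congr 2 <;> ring
  unfold angle
  conv_lhs => rw [prod_comm, limsup, map_map]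
  rw [limsup]
  congr 2
  funext z
  exact key _ _

theorem angle_triangle {Y : Type*} [MetricSpace Y] {p : Y} (c₁ c₂ c₃ : NontrivialGeodesic p) :
    angle c₁ c₃ ≤ angle c₁ c₂ + angle c₂ c₃ := by
  by_contra hcon
  push Not at hcon
  have hnn : ∀ c c' : NontrivialGeodesic p, 0 ≤ angle c c' := fun c c' =>
    le_limsup_of_frequently_le (Eventually.frequently
      (Eventually.of_forall fun _ => comparisonAngle_nonneg _ _ _)) (isBoundedUnder_le c c' _)
  have hpi : angle c₁ c₃ ≤ Real.pi :=
    limsup_le_of_le (isBoundedUnder_ge c₁ c₃ _).isCoboundedUnder_le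
      (Eventually.of_forall fun _ => comparisonAngle_le_pi _ _ _)
  obtain ⟨δ, hδ, hlt⟩ : ∃ δ > 0, angle c₁ c₂ + δ + (angle c₂ c₃ + δ) < angle c₁ c₃ :=
    ⟨(angle c₁ c₃ - (angle c₁ c₂ + angle c₂ c₃)) / 3, by linarith, by linarith⟩
  have ha : angle c₁ c₂ < angle c₁ c₂ + δ := by linarith
  have hb : angle c₂ c₃ < angle c₂ c₃ + δ := by linarith
  have ha0 : 0 < angle c₁ c₂ + δ := by linarith [hnn c₁ c₂]
  have hb0 : 0 < angle c₂ c₃ + δ := by linarith [hnn c₂ c₃]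
  generalize angle c₁ c₂ + δ = a at *
  generalize angle c₂ c₃ + δ = b at *
  obtain ⟨ε₁, hε₁, h12⟩ := exists_small (eventually_lt_of_limsup_lt ha (isBoundedUnder_le c₁ c₂ _))
  obtain ⟨ε₂, hε₂, h23⟩ := exists_small (eventually_lt_of_limsup_lt hb (isBoundedUnder_le c₂ c₃ _))
  have hfr := frequently_lt_of_lt_limsup (isBoundedUnder_ge c₁ c₃ _).isCoboundedUnder_le hlt
  obtain ⟨ε, hε, e1, e2, e3, e4, e5⟩ : ∃ ε > 0, ε ≤ ε₁ ∧ ε ≤ ε₂ ∧ ε ≤ c₁.length ∧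
      ε ≤ c₂.length ∧ ε ≤ c₃.length := by
    refine ⟨min ε₁ (min ε₂ (min c₁.length (min c₂.length c₃.length))), ?_, ?_⟩
    · simp [hε₁, hε₂, c₁.length_pos, c₂.length_pos, c₃.length_pos]
    · simp
  obtain ⟨⟨s, u⟩, h13, ⟨hs, hsε⟩, hu, huε⟩ := (hfr.and_eventually (eventually_small hε)).exists
  simp only at h13 hs hsε hu huε
  have hsa : 0 < Real.sin a := Real.sin_pos_of_pos_of_lt_pi ha0 (by linarith)
  have hsb : 0 < Real.sin b := Real.sin_pos_of_pos_of_lt_pi hb0 (by linarith)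
  have hsab : 0 < Real.sin (a + b) := Real.sin_pos_of_pos_of_lt_pi (by linarith) (by linarith)
  have hden : 0 < s * Real.sin a + u * Real.sin b := by positivity
  obtain ⟨l, hl⟩ : ∃ l, l = s * Real.sin a / (s * Real.sin a + u * Real.sin b) := ⟨_, rfl⟩
  have hl0 : 0 < l := by rw [hl]; positivity
  have hl1 : l < 1 := by
    rw [hl, div_lt_one hden]
    linarith [mul_pos hu hsb]
  have hleq : l * (s * Real.sin a + u * Real.sin b) = s * Real.sin a := by
    rw [hl]; field_simp
  obtain ⟨t, ht⟩ : ∃ t, t = (1 - l) * (s * Real.cos a) + l * (u * Real.cos b) := ⟨_, rfl⟩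
  have ht0 : 0 < t := by
    have : t * (s * Real.sin a + u * Real.sin b) = s * u * Real.sin (a + b) := by
      rw [Real.sin_add, ht]
      linear_combination (u * Real.cos b - s * Real.cos a) * hleq
    have h2 : 0 < t * (s * Real.sin a + u * Real.sin b) := by rw [this]; positivity
    exact pos_of_mul_pos_left h2 hden.le
  have htε : t < ε := by
    have h1 : s * Real.cos a ≤ s := by nlinarith [Real.cos_le_one a]
    have h2 : u * Real.cos b ≤ u := by nlinarith [Real.cos_le_one b]
    rw [ht]
    nlinarith [mul_lt_mul_of_pos_left (h1.trans_lt hsε) (sub_pos.2 hl1),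
      mul_lt_mul_of_pos_left (h2.trans_lt huε) hl0]
  have k12 := h12 s t hs (by linarith) ht0 (by linarith)
  have k23 := h23 t u ht0 (by linarith) hu (by linarith)
  simp only at k12 k23
  rw [comparisonAngle, dist_base _ hs.le (by linarith), dist_base _ ht0.le (by linarith)] at k12
  rw [comparisonAngle, dist_base _ ht0.le (by linarith), dist_base _ hu.le (by linarith)] at k23
  rw [comparisonAngle, dist_base _ hs.le (by linarith), dist_base _ hu.le (by linarith)] at h13
  have up : ∀ X θ : ℝ, 0 ≤ θ → θ ≤ Real.pi → Real.arccos X < θ → Real.cos θ < X := by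
    intro X θ h0 h1 h
    by_contra hX
    push Not at hX
    have := Real.antitone_arccos hX
    rw [Real.arccos_cos h0 h1] at this
    linarith
  have dn : ∀ X θ : ℝ, 0 ≤ θ → θ ≤ Real.pi → θ < Real.arccos X → X < Real.cos θ := by
    intro X θ h0 h1 h
    by_contra hX
    push Not at hX
    have := Real.antitone_arccos hX
    rw [Real.arccos_cos h0 h1] at this
    linarith
  have j12 := up _ _ ha0.le (by linarith) k12
  have j23 := up _ _ hb0.le (by linarith) k23
  have j13 := dn _ _ (by linarith) (by linarith) h13
  rw [lt_div_iff₀ (by positivity)] at j12 j23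
  rw [div_lt_iff₀ (by positivity), Real.cos_add] at j13
  have htri := dist_triangle (c₁.toFun s) (c₂.toFun t) (c₃.toFun u)
  have pa := Real.sin_sq_add_cos_sq a
  have pb := Real.sin_sq_add_cos_sq b
  obtain ⟨R, hR⟩ : ∃ R, R = Real.sqrt ((s * Real.cos a - u * Real.cos b) ^ 2 +
      (s * Real.sin a + u * Real.sin b) ^ 2) := ⟨_, rfl⟩
  have hR0 : 0 ≤ R := by rw [hR]; positivity
  have hR2 : R ^ 2 = (s * Real.cos a - u * Real.cos b) ^ 2 +
      (s * Real.sin a + u * Real.sin b) ^ 2 := by rw [hR]; exact Real.sq_sqrt (by positivity)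
  have q1 : s * Real.cos a - t = l * (s * Real.cos a - u * Real.cos b) := by rw [ht]; ring
  have q2 : t - u * Real.cos b = (1 - l) * (s * Real.cos a - u * Real.cos b) := by rw [ht]; ring
  have q3 : u * Real.sin b = (1 - l) * (s * Real.sin a + u * Real.sin b) := by
    linear_combination hleq
  have d12 : dist (c₁.toFun s) (c₂.toFun t) ≤ l * R := by
    refine abs_le_of_sq_le_sq' ?_ (by positivity) |>.2
    have : (l * R) ^ 2 = (s * Real.cos a - t) ^ 2 + (s * Real.sin a) ^ 2 := by
      rw [mul_pow, hR2, q1]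
      linear_combination (l * (s * Real.sin a + u * Real.sin b) + s * Real.sin a) * hleq
    rw [this]
    linear_combination j12 - s ^ 2 * pa
  have d23 : dist (c₂.toFun t) (c₃.toFun u) ≤ (1 - l) * R := by
    refine abs_le_of_sq_le_sq' ?_ (mul_nonneg (by linarith) hR0) |>.2
    have : ((1 - l) * R) ^ 2 = (t - u * Real.cos b) ^ 2 + (u * Real.sin b) ^ 2 := by
      rw [mul_pow, hR2, q2]
      linear_combination -((1 - l) * (s * Real.sin a + u * Real.sin b) + u * Real.sin b) * q3
    rw [this]
    linear_combination j23 - u ^ 2 * pb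
  have d13 : R < dist (c₁.toFun s) (c₃.toFun u) := by
    refine lt_of_pow_lt_pow_left₀ 2 dist_nonneg ?_
    rw [hR2]
    have : (s * Real.cos a - u * Real.cos b) ^ 2 + (s * Real.sin a + u * Real.sin b) ^ 2 =
        s ^ 2 + u ^ 2 - (Real.cos a * Real.cos b - Real.sin a * Real.sin b) * (2 * s * u) := by
      linear_combination s ^ 2 * pa + u ^ 2 * pb
    rw [this]
    linarith
  linarith

/-- The angle as a pseudometric on the set of nontrivial geodesics starting from `p`. -/
noncomputable instance instPseudoMetricSpace {Y : Type*} [MetricSpace Y] (p : Y) :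
    PseudoMetricSpace (NontrivialGeodesic p) where
  dist := angle
  dist_self := angle_self
  dist_comm := angle_comm
  dist_triangle := angle_triangle

end NontrivialGeodesic

/-- The space of directions at `p`: the (Hausdorff) completion of the set of nontrivial
geodesics starting from `p` with respect to the angle; two geodesics at angle `0` give the same
point. -/
abbrev SpaceOfDirections {Y : Type*} [MetricSpace Y] (p : Y) : Type _ :=
  UniformSpace.Completion (NontrivialGeodesic p)

/-- The tangent cone at `p`: the cone over the space of directions, with cone point `apex` and
points `ray u t` at distance `t > 0` from the cone point. (It is one point if there are no
directions at `p`.) -/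
inductive TangentCone {Y : Type*} [MetricSpace Y] (p : Y) where
  | apex : TangentCone p
  | ray (u : SpaceOfDirections p) (t : ℝ) (ht : 0 < t) : TangentCone p

namespace TangentCone

/-- The length `|v|`. -/
def length {Y : Type*} [MetricSpace Y] {p : Y} : TangentCone p → ℝ
  | apex => 0
  | ray _ t _ => t

/-- The inner product `⟨(u,t), (u',t')⟩ = t t' cos ∠(u,u')`. -/
noncomputable def inner {Y : Type*} [MetricSpace Y] {p : Y} : TangentCone p → TangentCone p → ℝ
  | ray u t _, ray u' t' _ => t * t' * Real.cos (dist u u')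
  | _, _ => 0

/-- The cone metric, `d(v,w)² = |v|² + |w|² - 2 ⟨v,w⟩`. -/
noncomputable instance {Y : Type*} [MetricSpace Y] (p : Y) : Dist (TangentCone p) where
  dist v w := Real.sqrt (v.length ^ 2 + w.length ^ 2 - 2 * inner v w)

end TangentCone

/-- A geodesic joining `p` to a different point `q` (unique in a CAT(0) space). -/
noncomputable def geodesicTo {Y : Type*} [MetricSpace Y] [CAT0Space Y] (p q : Y) (h : p ≠ q) :
    NontrivialGeodesic p where
  length := dist p q
  length_pos := dist_pos.2 h
  toFun := (CAT0Space.exists_geodesic p q).choose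
  map_zero := (CAT0Space.exists_geodesic p q).choose_spec.1
  dist_eq := (CAT0Space.exists_geodesic p q).choose_spec.2.2

open Classical in
/-- The natural projection `π_p` of `Y` to the tangent cone at `p`. -/
noncomputable def coneProj {Y : Type*} [MetricSpace Y] [CAT0Space Y] (p q : Y) : TangentCone p :=
  if h : p = q then TangentCone.apex
  else TangentCone.ray (geodesicTo p q h : SpaceOfDirections p) (dist p q) (dist_pos.2 h)

/-- `b` is the barycenter of the points `x i` with weights `w i` (finitely many of them nonzero,
of sum `1`): it is the unique minimizer of `q ↦ ∑ i, w i * d(x i, q)²`. -/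
def IsBarycenter {ι T : Type*} [Dist T] (w : ι → ℝ) (x : ι → T) (b : T) : Prop :=
  ∀ q : T, q ≠ b → ∑ᶠ i, w i * dist (x i) b ^ 2 < ∑ᶠ i, w i * dist (x i) q ^ 2

/-! ### Random walks and energies -/

/-- `μ` is the transition function of a `Γ`-invariant, finitely supported, symmetric and
irreducible random walk on `Γ`. -/
structure IsRandomWalk {Γ : Type*} [Group Γ] (μ : Γ → Γ → ℝ) : Prop where
  nonneg : ∀ γ γ', 0 ≤ μ γ γ'
  invariant : ∀ γ γ' γ'', μ (γ * γ') (γ * γ'') = μ γ' γ''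
  finite_support : ∀ γ, {γ' | μ γ γ' ≠ 0}.Finite
  sum_eq_one : ∀ γ, ∑ᶠ γ', μ γ γ' = 1
  symmetric : ∀ γ γ', μ γ γ' = μ γ' γ
  irreducible : ∀ γ γ', ∃ (n : ℕ) (g : ℕ → Γ), g 0 = γ ∧ g n = γ' ∧
    ∀ i < n, μ (g i) (g (i + 1)) ≠ 0

open Classical in
/-- The `n`-fold convolution `μⁿ`. -/
noncomputable def nStep {Γ : Type*} (μ : Γ → Γ → ℝ) : ℕ → Γ → Γ → ℝ
  | 0 => fun γ γ' => if γ = γ' then 1 else 0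
  | n + 1 => fun γ γ' => ∑ᶠ γ₁, μ γ γ₁ * nStep μ n γ₁ γ'

/-- `f` is equivariant with respect to the action `ρ`. -/
def IsEquivariant {Γ Y : Type*} [Group Γ] [MetricSpace Y] (ρ : Γ →* (Y ≃ᵢ Y)) (f : Γ → Y) :
    Prop :=
  ∀ γ γ', f (γ * γ') = ρ γ (f γ')

/-- The energy `E_μ(f) = ½ ∑ γ, μ(e,γ) d(f(e), f(γ))²`. -/
noncomputable def energy {Γ Y : Type*} [Group Γ] [MetricSpace Y] (μ : Γ → Γ → ℝ) (f : Γ → Y) : ℝ :=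
  1 / 2 * ∑ᶠ γ, μ 1 γ * dist (f 1) (f γ) ^ 2

/-- `v` is `-Δ_μ f(e)`, the barycenter of the push-forward of `μ(e, ·)` to the tangent cone
at `f(e)` under `γ ↦ π_{f(e)}(f(γ))`. -/
def IsNegLaplacian {Γ Y : Type*} [Group Γ] [MetricSpace Y] [CAT0Space Y] (μ : Γ → Γ → ℝ)
    (f : Γ → Y) (v : TangentCone (f 1)) : Prop :=
  IsBarycenter (μ 1) (fun γ => coneProj (f 1) (f γ)) v

/-! Fix an equivariant `f`, let E be its energy and let M(u) be the mean inner product of the unit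
direction u with the projected neighbours of f(e). The functional minimized by the barycenter is a
constant plus t² - 2tM(u) at (u,t), so the barycenter is governed by max M. The maximum, when
positive, is attained: midpoints in Y of short geodesics show that M is strictly concave in a
quantitative sense (`meanInner_add_le`), so maximizing sequences are Cauchy in the completed space
of directions. The length B of the barycenter is then max(0, sup M) (`exists_barycenter`).

Lower bound on B. In a CAT(0) space, projection to the tangent cone does not increase distances, so
averaging d(q,f(·))² over one step of the walk adds at least 2E - 2B·d(q,f(·)); equivariance gives
this at every group element (`le_average_dist_sq`). The mean distance itself grows by at most √(2E)
per step. Iterating n times from q = f(e) bounds twice the n-step energy below by 2nE - 2Bn²√(2E).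
The hypothesis bounds it above by 2(n-ε)E, whence ε√(2E) ≤ 2Bn² and B² ≥ CE with C = ε²/(2n⁴).

Fixed point. Regard the energy as a function of p = f(e). Moving p in a direction u lowers it at
rate at least 2M(u), by first variation of displacements and symmetry of μ
(`eventually_orbitEnergy_le`). As max M = B ≥ √(CE), the function √E can be decreased at a definite
rate wherever it is positive. Caristi's principle on the complete space Y yields a zero of the
energy, and irreducibility makes that point fixed by all of Γ. -/

/-! ### Quadratic comparison inequalities in CAT(0) spaces -/

section Comparison

variable {Y : Type*} [MetricSpace Y]

/-- A triangle with prescribed side lengths in the Euclidean plane. -/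
theorem exists_comparison_triangle {a b e : ℝ} (ha : 0 < a) (hb : 0 ≤ b) (he : 0 ≤ e)
    (h₁ : a ≤ b + e) (h₂ : b ≤ a + e) (h₃ : e ≤ a + b) :
    ∃ q r : EuclideanSpace ℝ (Fin 2), ‖q‖ = a ∧ ‖r‖ = b ∧ dist q r = e := by
  obtain ⟨x, hx⟩ : ∃ x, x = (a ^ 2 + b ^ 2 - e ^ 2) / (2 * a) := ⟨_, rfl⟩
  have hxa : 2 * a * x = a ^ 2 + b ^ 2 - e ^ 2 := by rw [hx]; field_simp
  have hxb : x ^ 2 ≤ b ^ 2 := by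
    refine sq_le_sq' ?_ ?_
    · have : 0 ≤ 2 * a * (x + b) := by nlinarith
      nlinarith [nonneg_of_mul_nonneg_right this (by positivity)]
    · have : 0 ≤ 2 * a * (b - x) := by nlinarith
      nlinarith [nonneg_of_mul_nonneg_right this (by positivity)]
  refine ⟨!₂[a, 0], !₂[x, Real.sqrt (b ^ 2 - x ^ 2)], ?_, ?_, ?_⟩
  · rw [EuclideanSpace.norm_eq]
    simp [Real.sqrt_sq ha.le]
  · rw [EuclideanSpace.norm_eq]
    simp [Real.sq_sqrt (sub_nonneg.2 hxb), Real.sqrt_sq hb]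
  · rw [EuclideanSpace.dist_eq]
    simp only [Fin.sum_univ_two, Real.dist_eq, sq_abs]
    simp only [Matrix.cons_val_zero, Matrix.cons_val_one]
    rw [zero_sub, neg_sq, Real.sq_sqrt (sub_nonneg.2 hxb), ← Real.sqrt_sq he]
    congr 1
    linear_combination -hxa

/-- The right side is the squared distance of the comparison points, with p' at the origin and the
inner product of q' and r' given by the law of cosines. This form of the CAT(0) condition is the one
applied below. -/
theorem dist_sq_le_of_isUnitSpeedGeodesic [CAT0Space Y] {p q r : Y} {c c' : ℝ → Y}
    (hc : IsUnitSpeedGeodesic c p q) (hc' : IsUnitSpeedGeodesic c' p r) (hq : p ≠ q) (hr : p ≠ r)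
    {s t : ℝ} (hs : s ∈ Set.Icc 0 (dist p q)) (ht : t ∈ Set.Icc 0 (dist p r)) :
    dist (c s) (c' t) ^ 2 ≤ s ^ 2 + t ^ 2 -
      (s / dist p q) * (t / dist p r) * (dist p q ^ 2 + dist p r ^ 2 - dist q r ^ 2) := by
  have ha := dist_pos.2 hq
  have hb := dist_pos.2 hr
  obtain ⟨q', r', hq', hr', hqr⟩ := exists_comparison_triangle (e := dist q r) ha hb.le dist_nonneg
    (by linarith [dist_triangle p r q, dist_comm r q]) (dist_triangle p q r)
    (by linarith [dist_triangle q p r, dist_comm q p])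
  have hα0 : 0 ≤ s / dist p q := div_nonneg hs.1 ha.le
  have hβ0 : 0 ≤ t / dist p r := div_nonneg ht.1 hb.le
  have hα1 : s / dist p q ≤ 1 := (div_le_one ha).2 hs.2
  have hβ1 : t / dist p r ≤ 1 := (div_le_one hb).2 ht.2
  have hsa : s / dist p q * dist p q = s := by field_simp
  have htb : t / dist p r * dist p r = t := by field_simp
  have hseg : ∀ (z : EuclideanSpace ℝ (Fin 2)) (k : ℝ), 0 ≤ k → k ≤ 1 →
      k • z ∈ segment ℝ 0 z := fun z k h0 h1 =>
    ⟨1 - k, k, by linarith, h0, by ring, by simp⟩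
  have key := CAT0Space.comparison p q r c c' hc hc' 0 q' r' (by simpa using hq')
    (by simpa using hr') hqr s hs t ht _ (hseg q' _ hα0 hα1) _ (hseg r' _ hβ0 hβ1)
    (by rw [dist_zero_left, norm_smul, hq', Real.norm_of_nonneg hα0, hsa])
    (by rw [dist_zero_left, norm_smul, hr', Real.norm_of_nonneg hβ0, htb])
  have hinner : 2 * inner ℝ q' r' = dist p q ^ 2 + dist p r ^ 2 - dist q r ^ 2 := by
    have := norm_sub_sq_real q' r'
    rw [← dist_eq_norm, hqr, hq', hr'] at this
    linarith
  have hexp := norm_sub_sq_real ((s / dist p q) • q') ((t / dist p r) • r')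
  rw [← dist_eq_norm, norm_smul, norm_smul, real_inner_smul_left, real_inner_smul_right, hq', hr',
    Real.norm_of_nonneg hα0, Real.norm_of_nonneg hβ0, hsa, htb] at hexp
  calc dist (c s) (c' t) ^ 2 ≤ _ := pow_le_pow_left₀ dist_nonneg key 2
    _ = _ := by rw [hexp, ← hinner]; ring

/-- The comparison inequality of Bruhat and Tits for a midpoint. -/
theorem exists_midpoint [CAT0Space Y] (q r : Y) : ∃ m : Y, ∀ p : Y,
    dist p m ^ 2 ≤ dist p q ^ 2 / 2 + dist p r ^ 2 / 2 - dist q r ^ 2 / 4 := by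
  rcases eq_or_ne q r with rfl | hqr
  · exact ⟨q, fun p => by simp⟩
  obtain ⟨c, hc⟩ := CAT0Space.exists_geodesic q r
  have ha := dist_pos.2 hqr
  have hs : dist q r / 2 ∈ Set.Icc 0 (dist q r) := ⟨by positivity, by linarith⟩
  refine ⟨c (dist q r / 2), fun p => ?_⟩
  rcases eq_or_ne q p with rfl | hqp
  · have h := hc.2.2 0 ⟨le_rfl, ha.le⟩ _ hs
    rw [hc.1] at h
    rw [h, sq_abs, dist_self]
    nlinarith
  obtain ⟨c', hc'⟩ := CAT0Space.exists_geodesic q p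
  -- The comparison is made at the vertex q, between the middle of the side to r and the far end p
  -- of the other side.
  have h := dist_sq_le_of_isUnitSpeedGeodesic hc hc' hqr hqp hs (Set.right_mem_Icc.2 dist_nonneg)
  rw [hc'.2.1, div_self (dist_pos.2 hqp).ne', div_right_comm, div_self ha.ne'] at h
  rw [dist_comm p, dist_comm p q, dist_comm p r]
  linarith

/-- The comparison triangle of p, q, q is degenerate. Uniqueness identifies images of the
arbitrarily chosen `geodesicTo` under isometries. -/
theorem IsUnitSpeedGeodesic.eq_of_mem [CAT0Space Y] {p q : Y} {c c' : ℝ → Y}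
    (hc : IsUnitSpeedGeodesic c p q) (hc' : IsUnitSpeedGeodesic c' p q) (hpq : p ≠ q) {s : ℝ}
    (hs : s ∈ Set.Icc 0 (dist p q)) : c s = c' s := by
  have h := dist_sq_le_of_isUnitSpeedGeodesic hc hc' hpq hpq hs hs
  have ha := (dist_pos.2 hpq).ne'
  have : s ^ 2 + s ^ 2 - s / dist p q * (s / dist p q) *
      (dist p q ^ 2 + dist p q ^ 2 - dist q q ^ 2) = 0 := by
    rw [dist_self]; field_simp; ring
  rw [this] at h
  exact dist_eq_zero.1 (pow_eq_zero_iff two_ne_zero |>.1 (le_antisymm h (by positivity)))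

theorem IsUnitSpeedGeodesic.reverse {p q : Y} {c : ℝ → Y} (hc : IsUnitSpeedGeodesic c p q) :
    IsUnitSpeedGeodesic (fun s => c (dist p q - s)) q p := by
  refine ⟨by simpa using hc.2.1, by simpa [dist_comm q p] using hc.1, fun s hs t ht => ?_⟩
  rw [dist_comm q p] at hs ht
  rw [hc.2.2 _ ⟨by linarith [hs.2], by linarith [hs.1]⟩ _ ⟨by linarith [ht.2], by linarith [ht.1]⟩,
    abs_sub_comm]
  congr 1; ring

end Comparison

/-! ### Monotonicity of comparison angles and first variation -/

namespace NontrivialGeodesic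

variable {Y : Type*} [MetricSpace Y] {p : Y}

theorem isUnitSpeedGeodesic (c : NontrivialGeodesic p) {s : ℝ} (h0 : 0 ≤ s) (h1 : s ≤ c.length) :
    IsUnitSpeedGeodesic c.toFun p (c.toFun s) := by
  rw [IsUnitSpeedGeodesic, c.dist_base h0 h1]
  exact ⟨c.map_zero, rfl, fun x hx y hy =>
    c.dist_eq x ⟨hx.1, hx.2.trans h1⟩ y ⟨hy.1, hy.2.trans h1⟩⟩

theorem ne_base (c : NontrivialGeodesic p) {s : ℝ} (h0 : 0 < s) (h1 : s ≤ c.length) :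
    p ≠ c.toFun s := by
  rw [← dist_pos, c.dist_base h0.le h1]; exact h0

theorem cos_comparisonAngle (c c' : NontrivialGeodesic p) {s t : ℝ} (hs : 0 < s)
    (hs' : s ≤ c.length) (ht : 0 < t) (ht' : t ≤ c'.length) :
    2 * s * t * Real.cos (comparisonAngle p (c.toFun s) (c'.toFun t)) =
      s ^ 2 + t ^ 2 - dist (c.toFun s) (c'.toFun t) ^ 2 := by
  have h1 := dist_triangle (c.toFun s) p (c'.toFun t)
  have h2 := dist_triangle p (c.toFun s) (c'.toFun t)
  have h3 := dist_triangle p (c'.toFun t) (c.toFun s)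
  rw [dist_comm (c.toFun s) p] at h1
  rw [dist_comm (c'.toFun t) (c.toFun s)] at h3
  rw [comparisonAngle]
  rw [c.dist_base hs.le hs', c'.dist_base ht.le ht'] at *
  have hd := dist_nonneg (x := c.toFun s) (y := c'.toFun t)
  generalize dist (c.toFun s) (c'.toFun t) = d at *
  rw [Real.cos_arccos]
  · field_simp
  · rw [le_div_iff₀ (by positivity)]; nlinarith
  · rw [div_le_iff₀ (by positivity)]; nlinarith

/-- Shortening the sides of the large comparison triangle to s and t keeps its angle at p, and
CAT(0) says that the true third side is no longer than the resulting one; the law of cosines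
converts this to angles. -/
theorem comparisonAngle_mono [CAT0Space Y] (c c' : NontrivialGeodesic p) {s t s' t' : ℝ}
    (hs : 0 < s) (hss' : s ≤ s') (hs' : s' ≤ c.length) (ht : 0 < t) (htt' : t ≤ t')
    (ht' : t' ≤ c'.length) :
    comparisonAngle p (c.toFun s) (c'.toFun t) ≤ comparisonAngle p (c.toFun s') (c'.toFun t') := by
  have hs0 := hs.trans_le hss'
  have ht0 := ht.trans_le htt'
  have h := dist_sq_le_of_isUnitSpeedGeodesic (c.isUnitSpeedGeodesic hs0.le hs')
    (c'.isUnitSpeedGeodesic ht0.le ht') (c.ne_base hs0 hs') (c'.ne_base ht0 ht')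
    (s := s) (t := t) (by rw [c.dist_base hs0.le hs']; exact ⟨hs.le, hss'⟩)
    (by rw [c'.dist_base ht0.le ht']; exact ⟨ht.le, htt'⟩)
  rw [c.dist_base hs0.le hs', c'.dist_base ht0.le ht'] at h
  have e1 := cos_comparisonAngle c c' hs (hss'.trans hs') ht (htt'.trans ht')
  have e2 := cos_comparisonAngle c c' hs0 hs' ht0 ht'
  have hcos : Real.cos (comparisonAngle p (c.toFun s') (c'.toFun t')) ≤
      Real.cos (comparisonAngle p (c.toFun s) (c'.toFun t)) := by
    rw [← e2] at h
    have h' : s / s' * (t / t') * (2 * s' * t' *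
        Real.cos (comparisonAngle p (c.toFun s') (c'.toFun t'))) =
        2 * s * t * Real.cos (comparisonAngle p (c.toFun s') (c'.toFun t')) := by
      field_simp
    rw [h'] at h
    refine le_of_mul_le_mul_left (a := 2 * s * t) ?_ (by positivity)
    linarith
  by_contra! hlt
  exact absurd hcos (not_le.2 (Real.cos_lt_cos_of_nonneg_of_le_pi (comparisonAngle_nonneg _ _ _)
    (comparisonAngle_le_pi _ _ _) hlt))

theorem angle_nonneg (c c' : NontrivialGeodesic p) : 0 ≤ angle c c' :=
  le_limsup_of_frequently_le (Eventually.frequently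
    (Eventually.of_forall fun _ => comparisonAngle_nonneg _ _ _)) (isBoundedUnder_le c c' _)

theorem angle_le_pi (c c' : NontrivialGeodesic p) : angle c c' ≤ Real.pi :=
  limsup_le_of_le (isBoundedUnder_ge c c' _).isCoboundedUnder_le
    (Eventually.of_forall fun _ => comparisonAngle_le_pi _ _ _)

theorem angle_le_comparisonAngle [CAT0Space Y] (c c' : NontrivialGeodesic p) {s t : ℝ}
    (hs : 0 < s) (hs' : s ≤ c.length) (ht : 0 < t) (ht' : t ≤ c'.length) :
    angle c c' ≤ comparisonAngle p (c.toFun s) (c'.toFun t) := by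
  refine limsup_le_of_le (isBoundedUnder_ge c c' _).isCoboundedUnder_le ?_
  filter_upwards [eventually_small (lt_min hs ht)] with z hz
  exact comparisonAngle_mono c c' hz.1.1 (hz.1.2.le.trans (min_le_left _ _)) hs' hz.2.1
    (hz.2.2.le.trans (min_le_right _ _)) (ht' : t ≤ c'.length)

/-- The distance between points on two geodesics issuing from `p` is at least the one in the
tangent cone. -/
theorem le_dist_sq [CAT0Space Y] (c c' : NontrivialGeodesic p) {s t : ℝ}
    (hs : 0 < s) (hs' : s ≤ c.length) (ht : 0 < t) (ht' : t ≤ c'.length) :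
    s ^ 2 + t ^ 2 - 2 * s * t * Real.cos (angle c c') ≤ dist (c.toFun s) (c'.toFun t) ^ 2 := by
  have h := Real.cos_le_cos_of_nonneg_of_le_pi (angle_nonneg c c') (comparisonAngle_le_pi _ _ _)
    (angle_le_comparisonAngle c c' hs hs' ht ht')
  have e := cos_comparisonAngle c c' hs hs' ht ht'
  have := mul_le_mul_of_nonneg_left h (show 0 ≤ 2 * s * t by positivity)
  linarith

/-- Infinitesimally, the distance between points on two geodesics issuing from `p` is at most the
one in the tangent cone. -/
theorem exists_dist_sq_le (c c' : NontrivialGeodesic p) {δ : ℝ} (hδ : 0 < δ) :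
    ∃ η > 0, η ≤ c.length ∧ η ≤ c'.length ∧ ∀ s t : ℝ, 0 < s → s < η → 0 < t → t < η →
      dist (c.toFun s) (c'.toFun t) ^ 2 ≤
        s ^ 2 + t ^ 2 - 2 * s * t * (Real.cos (angle c c') - δ) := by
  obtain ⟨ε, hε, h⟩ := exists_small (eventually_lt_of_limsup_lt
    (show angle c c' < angle c c' + δ by linarith) (isBoundedUnder_le c c' _))
  refine ⟨min ε (min c.length c'.length), by simp [hε, c.length_pos, c'.length_pos], by simp,
    by simp, fun s t hs hs' ht ht' => ?_⟩
  simp only [lt_min_iff] at hs' ht'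
  have h1 := h s t hs hs'.1 ht ht'.1
  have e := cos_comparisonAngle c c' hs hs'.2.1.le ht ht'.2.2.le
  simp only at h1
  have hθ := comparisonAngle_nonneg p (c.toFun s) (c'.toFun t)
  generalize comparisonAngle p (c.toFun s) (c'.toFun t) = θ at *
  have hcos : Real.cos (angle c c') - δ ≤ Real.cos θ := by
    rcases le_total θ (angle c c') with hle | hle
    · linarith [Real.cos_le_cos_of_nonneg_of_le_pi hθ (angle_le_pi c c') hle]
    · have := (le_abs_self _).trans (Real.abs_cos_sub_cos_le (angle c c') θ)
      rw [abs_sub_comm, abs_of_nonneg (sub_nonneg.2 hle)] at this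
      linarith
  have := mul_le_mul_of_nonneg_left hcos (show 0 ≤ 2 * s * t by positivity)
  linarith

/-- First variation: the distance from `c t` to `c' s` decreases to first order by
`t * cos (angle c c')` at least. -/
theorem exists_dist_le (c c' : NontrivialGeodesic p) {δ : ℝ} (hδ : 0 < δ) :
    ∃ η > 0, ∀ s : ℝ, 0 < s → s < η → ∀ᶠ t in 𝓝[>] (0 : ℝ),
      dist (c.toFun t) (c'.toFun s) ≤ s - t * (Real.cos (angle c c') - δ) := by
  obtain ⟨η, hη, -, -, h⟩ := exists_dist_sq_le c c' (half_pos hδ)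
  refine ⟨η, hη, fun s hs hsη => ?_⟩
  -- The bound t < sδ lets the spare δ/2 in the cosine absorb the term t²; the last bound keeps s -
  -- t(cos - δ) nonnegative, so that squares can be compared.
  have hev : ∀ᶠ t in 𝓝[>] (0 : ℝ),
      t < min η (min (s * δ) (s / (|Real.cos (angle c c') - δ| + 1))) :=
    mem_nhdsWithin_of_mem_nhds (Iio_mem_nhds (by positivity))
  filter_upwards [hev, self_mem_nhdsWithin] with t ht ht0
  simp only [lt_min_iff] at ht
  obtain ⟨h1, h2, h3⟩ := ht
  have ht0 : 0 < t := ht0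
  rw [lt_div_iff₀ (by positivity)] at h3
  have h4 := h t s ht0 h1 hs hsη
  generalize Real.cos (angle c c') = k at *
  have hk : t * (k - δ) ≤ s := by nlinarith [le_abs_self (k - δ)]
  refine abs_le_of_sq_le_sq' (h4.trans ?_) (by linarith) |>.2
  nlinarith [sq_nonneg (t * (k - δ)), mul_pos ht0 hs]

end NontrivialGeodesic

/-! ### Directional derivatives and barycenters in the tangent cone -/

section Cone

variable {Y : Type*} [MetricSpace Y] {p : Y}

theorem SpaceOfDirections.dist_le_pi (u v : SpaceOfDirections p) : dist u v ≤ Real.pi := by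
  induction u, v using UniformSpace.Completion.induction_on₂ with
  | hp => exact isClosed_le (by fun_prop) continuous_const
  | ih c c' =>
    rw [UniformSpace.Completion.dist_eq]
    exact NontrivialGeodesic.angle_le_pi c c'

theorem TangentCone.length_nonneg (v : TangentCone p) : 0 ≤ v.length := by
  cases v with
  | apex => exact le_rfl
  | ray u t ht => exact ht.le

theorem TangentCone.dist_sq (v w : TangentCone p) :
    dist v w ^ 2 = v.length ^ 2 + w.length ^ 2 - 2 * TangentCone.inner v w := by
  refine Real.sq_sqrt ?_
  cases v with
  | apex => simp only [TangentCone.inner, TangentCone.length, mul_zero, sub_zero]; positivity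
  | ray u t ht =>
    cases w with
    | apex => simp only [TangentCone.inner, TangentCone.length, mul_zero, sub_zero]; positivity
    | ray u' t' ht' =>
      simp only [TangentCone.inner, TangentCone.length]
      nlinarith [sq_nonneg (t - t'), mul_nonneg (mul_pos ht ht').le
        (sub_nonneg.2 (Real.cos_le_one (dist u u')))]

variable [CAT0Space Y]

/-- The inner product of `π_p(x)` with the unit vector in the direction `u`. -/
noncomputable def dirInner (p x : Y) (u : SpaceOfDirections p) : ℝ :=
  TangentCone.inner (coneProj p x) (TangentCone.ray u 1 one_pos)

theorem dirInner_self (u : SpaceOfDirections p) : dirInner p p u = 0 := by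
  simp [dirInner, coneProj, TangentCone.inner]

theorem dirInner_of_ne {x : Y} (h : p ≠ x) (u : SpaceOfDirections p) :
    dirInner p x u = dist p x * Real.cos (dist (geodesicTo p x h : SpaceOfDirections p) u) := by
  simp [dirInner, coneProj, TangentCone.inner, h]

theorem dirInner_coe_of_ne {x : Y} (h : p ≠ x) (c : NontrivialGeodesic p) :
    dirInner p x c = dist p x * Real.cos ((geodesicTo p x h).angle c) := by
  rw [dirInner_of_ne h, UniformSpace.Completion.dist_eq]; rfl

theorem continuous_dirInner (p x : Y) : Continuous (dirInner p x) := by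
  rcases eq_or_ne p x with rfl | h
  · simpa only [funext (dirInner_self (p := p))] using continuous_const
  · simp only [funext (dirInner_of_ne h)]
    fun_prop

theorem dirInner_le_dist (x : Y) (u : SpaceOfDirections p) : dirInner p x u ≤ dist p x := by
  rcases eq_or_ne p x with rfl | h
  · rw [dirInner_self, dist_self]
  · rw [dirInner_of_ne h]
    exact mul_le_of_le_one_right dist_nonneg (Real.cos_le_one _)

theorem length_coneProj (p x : Y) : (coneProj p x).length = dist p x := by
  unfold coneProj
  split_ifs with h
  · simp [h, TangentCone.length]
  · rfl

theorem inner_coneProj_ray (x : Y) (u : SpaceOfDirections p) {t : ℝ} (ht : 0 < t) :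
    TangentCone.inner (coneProj p x) (TangentCone.ray u t ht) = t * dirInner p x u := by
  unfold dirInner coneProj
  split_ifs with h
  · simp [TangentCone.inner]
  · simp only [TangentCone.inner]; ring

theorem geodesicTo_length (x : Y) (h : p ≠ x) :
    (geodesicTo p x h).toFun (geodesicTo p x h).length = x :=
  (CAT0Space.exists_geodesic p x).choose_spec.2.1

/-- The projection to the tangent cone does not increase distances. -/
theorem dist_sq_ge_of_dirInner (x y : Y) (h : p ≠ y) :
    dist p x ^ 2 + dist p y ^ 2 - 2 * dist p y * dirInner p x (geodesicTo p y h) ≤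
      dist x y ^ 2 := by
  rcases eq_or_ne p x with rfl | hx
  · simp [dirInner_self]
  have := NontrivialGeodesic.le_dist_sq (geodesicTo p x hx) (geodesicTo p y h)
    (geodesicTo p x hx).length_pos le_rfl (geodesicTo p y h).length_pos le_rfl
  rw [geodesicTo_length, geodesicTo_length] at this
  rw [dirInner_coe_of_ne hx]
  simp only [geodesicTo] at this ⊢
  linarith

/-- The inner products with `π_p(x)`, `x ∈ I`, are approximately concave along approximate
midpoints of directions. -/
theorem exists_approx_midpoint_direction {ι : Type*} (I : Finset ι) (x : ι → Y)
    (c₁ c₂ : NontrivialGeodesic p) {δ : ℝ} (hδ : 0 < δ) :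
    ∃ (u : SpaceOfDirections p) (l : ℝ), 0 ≤ l ∧
      l ^ 2 ≤ (1 + Real.cos (dist (c₁ : SpaceOfDirections p) c₂)) / 2 ∧
      ∀ i ∈ I, (dirInner p (x i) c₁ + dirInner p (x i) c₂) / 2 - dist p (x i) * δ ≤
        l * dirInner p (x i) u := by
  -- The geodesics to the x i are probed at distance Rs, while c₁ and c₂ are probed at distance s.
  -- The quadratic term s² equals δ·(Rs)·s, hence is negligible against the cross terms.
  obtain ⟨R, hR⟩ : ∃ R, R = 1 / δ := ⟨_, rfl⟩
  have hR0 : 0 < R := by rw [hR]; positivity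
  have hRδ : R * δ = 1 := by rw [hR]; field_simp
  obtain ⟨η, hη, H⟩ : ∃ η > 0, ∀ i ∈ I, ∀ h : p ≠ x i, η ≤ (geodesicTo p (x i) h).length ∧
      ∀ s t : ℝ, 0 < s → s < η → 0 < t → t < η →
      dist ((geodesicTo p (x i) h).toFun s) (c₁.toFun t) ^ 2 ≤
        s ^ 2 + t ^ 2 - 2 * s * t * (Real.cos ((geodesicTo p (x i) h).angle c₁) - δ / 2) ∧
      dist ((geodesicTo p (x i) h).toFun s) (c₂.toFun t) ^ 2 ≤
        s ^ 2 + t ^ 2 - 2 * s * t * (Real.cos ((geodesicTo p (x i) h).angle c₂) - δ / 2) := by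
    have h1 : ∀ i, ∃ η > 0, ∀ h : p ≠ x i, η ≤ (geodesicTo p (x i) h).length ∧
      ∀ s t : ℝ, 0 < s → s < η → 0 < t → t < η →
      dist ((geodesicTo p (x i) h).toFun s) (c₁.toFun t) ^ 2 ≤
        s ^ 2 + t ^ 2 - 2 * s * t * (Real.cos ((geodesicTo p (x i) h).angle c₁) - δ / 2) ∧
      dist ((geodesicTo p (x i) h).toFun s) (c₂.toFun t) ^ 2 ≤
        s ^ 2 + t ^ 2 - 2 * s * t * (Real.cos ((geodesicTo p (x i) h).angle c₂) - δ / 2) := by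
      intro i
      by_cases h : p = x i
      · exact ⟨1, one_pos, fun h' => absurd h h'⟩
      obtain ⟨η₁, h₁, hl, -, H₁⟩ := (geodesicTo p (x i) h).exists_dist_sq_le c₁ (half_pos hδ)
      obtain ⟨η₂, h₂, -, -, H₂⟩ := (geodesicTo p (x i) h).exists_dist_sq_le c₂ (half_pos hδ)
      refine ⟨min η₁ η₂, lt_min h₁ h₂, fun _ => ⟨(min_le_left _ _).trans hl,
        fun s t hs hs' ht ht' => ?_⟩⟩
      rw [lt_min_iff] at hs' ht'
      exact ⟨H₁ s t hs hs'.1 ht ht'.1, H₂ s t hs hs'.2 ht ht'.2⟩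
    choose η hη H using h1
    rcases I.eq_empty_or_nonempty with rfl | hI
    · exact ⟨1, one_pos, by simp⟩
    refine ⟨I.inf' hI η, (Finset.lt_inf'_iff hI).2 fun i _ => hη i, fun i hi h => ?_⟩
    have hle : I.inf' hI η ≤ η i := Finset.inf'_le _ hi
    exact ⟨hle.trans (H i h).1, fun s t hs hs' ht ht' =>
      (H i h).2 s t hs (hs'.trans_le hle) ht (ht'.trans_le hle)⟩
  obtain ⟨s, hs, hsη, hRs, hs1, hs2⟩ : ∃ s > 0, s < η ∧ R * s < η ∧ s ≤ c₁.length ∧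
      s ≤ c₂.length := by
    obtain ⟨s, hs, hs'⟩ := exists_between
      (show 0 < min (min η (η / R)) (min c₁.length c₂.length) by
        have := c₁.length_pos
        have := c₂.length_pos
        positivity)
    simp only [lt_min_iff, lt_div_iff₀ hR0] at hs'
    exact ⟨s, hs, hs'.1.1, by linarith, hs'.2.1.le, hs'.2.2.le⟩
  have hRs0 : 0 < R * s := mul_pos hR0 hs
  obtain ⟨m, hm⟩ := exists_midpoint (c₁.toFun s) (c₂.toFun s)
  -- The midpoint inequality gives d(p,m)² ≤ s² - d(c₁ s, c₂ s)²/4; the angle bounds the last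
  -- distance below, so l = d(p,m)/s is at most the cosine of half the angle.
  have hd := NontrivialGeodesic.le_dist_sq c₁ c₂ hs hs1 hs hs2
  have hl2 : (dist p m / s) ^ 2 ≤
      (1 + Real.cos (dist (c₁ : SpaceOfDirections p) c₂)) / 2 := by
    rw [UniformSpace.Completion.dist_eq]
    change _ ≤ (1 + Real.cos (c₁.angle c₂)) / 2
    have := hm p
    rw [c₁.dist_base hs.le hs1, c₂.dist_base hs.le hs2] at this
    rw [div_pow, div_le_iff₀ (by positivity)]
    linarith
  -- the required inequality, given a lower bound for the distance to `m`
  have key : ∀ i ∈ I, ∀ h : p ≠ x i, ∀ k : ℝ,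
      (R * s) ^ 2 + dist p m ^ 2 - 2 * (R * s) * (dist p m * k) ≤
        dist ((geodesicTo p (x i) h).toFun (R * s)) m ^ 2 →
      (dirInner p (x i) c₁ + dirInner p (x i) c₂) / 2 - dist p (x i) * δ ≤
        dist p m / s * (dist p (x i) * k) := by
    intro i hi h k hk
    obtain ⟨H1, H2⟩ := (H i hi h).2 (R * s) s hRs0 hRs hs hsη
    have H3 := hm ((geodesicTo p (x i) h).toFun (R * s))
    rw [dirInner_coe_of_ne h, dirInner_coe_of_ne h]
    generalize Real.cos ((geodesicTo p (x i) h).angle c₁) = k₁ at *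
    generalize Real.cos ((geodesicTo p (x i) h).angle c₂) = k₂ at *
    have hk' : (R * s) * s * ((k₁ + k₂) / 2 - δ) ≤ (R * s) * s * (dist p m / s * k) := by
      have e : (R * s) * s * (dist p m / s * k) = (R * s) * (dist p m * k) := by field_simp
      rw [e]
      have e2 : R * s * s * δ = s ^ 2 := by linear_combination s ^ 2 * hRδ
      nlinarith [sq_nonneg (dist p m), sq_nonneg (dist (c₁.toFun s) (c₂.toFun s))]
    have hk'' := le_of_mul_le_mul_left hk' (by positivity)
    have := mul_le_mul_of_nonneg_left hk'' (dist_nonneg (x := p) (y := x i))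
    linarith
  by_cases hpm : p = m
  -- Here l = 0, so the choice of direction is immaterial.
  · refine ⟨c₁, dist p m / s, by positivity, hl2, fun i hi => ?_⟩
    by_cases h : p = x i
    · rw [← h]; simp [dirInner_self]
    conv_rhs => rw [dirInner_coe_of_ne h c₁]
    refine key i hi h _ ?_
    rw [← hpm, dist_comm (NontrivialGeodesic.toFun _ _) p, NontrivialGeodesic.dist_base _ hRs0.le
      (hRs.le.trans (H i hi h).1), dist_self]
    linarith
  · refine ⟨geodesicTo p m hpm, dist p m / s, by positivity, hl2, fun i hi => ?_⟩
    by_cases h : p = x i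
    · rw [← h]; simp [dirInner_self]
    rw [dirInner_coe_of_ne h (geodesicTo p m hpm)]
    refine key i hi h _ ?_
    have := NontrivialGeodesic.le_dist_sq (geodesicTo p (x i) h) (geodesicTo p m hpm)
      (s := R * s) hRs0 (hRs.le.trans (H i hi h).1) (geodesicTo p m hpm).length_pos le_rfl
    rw [geodesicTo_length] at this
    simp only [geodesicTo] at this ⊢
    linarith

end Cone

/-! ### Maximizing directions and barycenters -/

section Barycenter

variable {Y : Type*} [MetricSpace Y] [CAT0Space Y] {p : Y} {ι : Type*}

/-- The weighted sum of the inner products of the `π_p(x i)` with the unit vector `u`. -/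
noncomputable def meanInner (p : Y) (I : Finset ι) (w : ι → ℝ) (x : ι → Y)
    (u : SpaceOfDirections p) : ℝ :=
  ∑ i ∈ I, w i * dirInner p (x i) u

theorem continuous_meanInner (I : Finset ι) (w : ι → ℝ) (x : ι → Y) :
    Continuous (meanInner p I w x) :=
  continuous_finsetSum _ fun i _ => continuous_const.mul (continuous_dirInner p (x i))

theorem bddAbove_meanInner {I : Finset ι} {w : ι → ℝ} (hw : ∀ i ∈ I, 0 ≤ w i) (x : ι → Y) :
    BddAbove (Set.range (meanInner p I w x)) := by
  refine ⟨∑ i ∈ I, w i * dist p (x i), ?_⟩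
  rintro _ ⟨u, rfl⟩
  exact Finset.sum_le_sum fun i hi => mul_le_mul_of_nonneg_left (dirInner_le_dist _ _) (hw i hi)

/-- In the cone, the midpoint of two unit vectors at angle θ has length cos(θ/2), and inner products
are concave along it. Approximate midpoints realize this for actual geodesics; density and
continuity extend it to the completion. -/
theorem meanInner_add_le {I : Finset ι} {w : ι → ℝ} (hw : ∀ i ∈ I, 0 ≤ w i) (x : ι → Y)
    {S : ℝ} (hS : 0 ≤ S) (hM : ∀ u, meanInner p I w x u ≤ S) (u₁ u₂ : SpaceOfDirections p) :
    (meanInner p I w x u₁ + meanInner p I w x u₂) / 2 ≤ S * Real.cos (dist u₁ u₂ / 2) := by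
  have hcont := continuous_meanInner (p := p) I w x
  induction u₁, u₂ using UniformSpace.Completion.induction_on₂ with
  | hp => exact isClosed_le (by fun_prop) (by fun_prop)
  | ih c₁ c₂ =>
    have hc : Real.cos (dist (c₁ : SpaceOfDirections p) c₂ / 2) =
        √((1 + Real.cos (dist (c₁ : SpaceOfDirections p) c₂)) / 2) :=
      Real.cos_half (by linarith [dist_nonneg (x := (c₁ : SpaceOfDirections p)) (y := c₂),
        Real.pi_pos]) (SpaceOfDirections.dist_le_pi _ _)
    obtain ⟨D, hD⟩ : ∃ D, D = ∑ i ∈ I, w i * dist p (x i) := ⟨_, rfl⟩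
    have hD0 : 0 ≤ D := hD ▸ Finset.sum_nonneg fun i hi => mul_nonneg (hw i hi) dist_nonneg
    refine le_of_forall_pos_le_add fun δ hδ => ?_
    obtain ⟨u, l, hl0, hl, h⟩ := exists_approx_midpoint_direction I x c₁ c₂
      (show 0 < δ / (D + 1) by positivity)
    have hl' : l ≤ Real.cos (dist (c₁ : SpaceOfDirections p) c₂ / 2) :=
      hc ▸ Real.le_sqrt_of_sq_le hl
    have h1 : (meanInner p I w x c₁ + meanInner p I w x c₂) / 2 - D * (δ / (D + 1)) ≤
        l * meanInner p I w x u := by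
      rw [hD, meanInner, meanInner, meanInner, ← Finset.sum_add_distrib, Finset.sum_div,
        Finset.sum_mul, ← Finset.sum_sub_distrib, Finset.mul_sum]
      refine Finset.sum_le_sum fun i hi => ?_
      have := mul_le_mul_of_nonneg_left (h i hi) (hw i hi)
      rw [← hD]
      linarith
    have h2 : D * (δ / (D + 1)) ≤ δ := by
      rw [mul_div_assoc', div_le_iff₀ (by positivity)]; nlinarith
    have h3 := mul_le_mul_of_nonneg_left (hM u) hl0
    have h4 := mul_le_mul_of_nonneg_left hl' hS
    linarith

/-- Inserts cos x ≤ 1 - 2x²/π² into the midpoint bound. Near-maximizers are therefore close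
together, which gives both existence and uniqueness of the maximizer. -/
theorem dist_sq_le_of_meanInner {I : Finset ι} {w : ι → ℝ} (hw : ∀ i ∈ I, 0 ≤ w i) (x : ι → Y)
    {S : ℝ} (hS : 0 < S) (hM : ∀ u, meanInner p I w x u ≤ S) (u₁ u₂ : SpaceOfDirections p) :
    dist u₁ u₂ ^ 2 ≤
      Real.pi ^ 2 / S * ((S - meanInner p I w x u₁) + (S - meanInner p I w x u₂)) := by
  have h := meanInner_add_le hw x hS.le hM u₁ u₂
  have hπ := Real.pi_pos
  have hd := dist_nonneg (x := u₁) (y := u₂)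
  have hdπ := SpaceOfDirections.dist_le_pi u₁ u₂
  have hcos := Real.cos_le_one_sub_mul_cos_sq (x := dist u₁ u₂ / 2)
    (by rw [abs_of_nonneg (by positivity)]; linarith)
  have h2 := h.trans (mul_le_mul_of_nonneg_left hcos hS.le)
  have e : S * (1 - 2 / Real.pi ^ 2 * (dist u₁ u₂ / 2) ^ 2) =
      S - S / (2 * Real.pi ^ 2) * dist u₁ u₂ ^ 2 := by field_simp
  rw [e] at h2
  have h3 : S / (2 * Real.pi ^ 2) * dist u₁ u₂ ^ 2 ≤
      ((S - meanInner p I w x u₁) + (S - meanInner p I w x u₂)) / 2 := by linarith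
  have h4 := mul_le_mul_of_nonneg_left h3 (show 0 ≤ 2 * Real.pi ^ 2 / S by positivity)
  have e2 : 2 * Real.pi ^ 2 / S * (S / (2 * Real.pi ^ 2) * dist u₁ u₂ ^ 2) = dist u₁ u₂ ^ 2 := by
    field_simp
  rw [e2] at h4
  refine h4.trans_eq ?_
  ring

/-- If the mean inner product takes a positive value, it attains its maximum. -/
theorem exists_forall_meanInner_le {I : Finset ι} {w : ι → ℝ} (hw : ∀ i ∈ I, 0 ≤ w i)
    (x : ι → Y) {u₀ : SpaceOfDirections p} (h₀ : 0 < meanInner p I w x u₀) :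
    ∃ u, ∀ u', meanInner p I w x u' ≤ meanInner p I w x u := by
  have hbdd := bddAbove_meanInner (p := p) hw x
  obtain ⟨S, hSdef⟩ : ∃ S, S = ⨆ u, meanInner p I w x u := ⟨_, rfl⟩
  have hM : ∀ u, meanInner p I w x u ≤ S := fun u => hSdef ▸ le_ciSup hbdd u
  have hS : 0 < S := h₀.trans_le (hM u₀)
  have : Nonempty (SpaceOfDirections p) := ⟨u₀⟩
  have hex : ∀ k : ℕ, ∃ u, S - 1 / ((k : ℝ) + 1) < meanInner p I w x u := fun k =>
    exists_lt_of_lt_ciSup (by rw [← hSdef]; linarith [Nat.one_div_pos_of_nat (α := ℝ) (n := k)])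
  choose u hu using hex
  have hlim : Tendsto
      (fun k : ℕ => Real.sqrt (Real.pi ^ 2 / S * (1 / ((k : ℝ) + 1) + 1 / ((k : ℝ) + 1))))
      atTop (𝓝 0) := by
    have h := tendsto_one_div_add_atTop_nhds_zero_nat (𝕜 := ℝ)
    have h2 := ((h.add h).const_mul (Real.pi ^ 2 / S)).sqrt
    simpa using h2
  -- Beyond index N all values lie within 1/(N+1) of the supremum.
  have hcauchy : CauchySeq u := by
    refine cauchySeq_of_le_tendsto_0 _ (fun m n N hm hn => ?_) hlim
    refine Real.le_sqrt_of_sq_le ((dist_sq_le_of_meanInner hw x hS hM _ _).trans ?_)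
    refine mul_le_mul_of_nonneg_left ?_ (by positivity)
    have e1 := Nat.one_div_le_one_div (α := ℝ) hm
    have e2 := Nat.one_div_le_one_div (α := ℝ) hn
    linarith [hu m, hu n]
  obtain ⟨v, hv⟩ := cauchySeq_tendsto_of_complete hcauchy
  refine ⟨v, fun u' => (hM u').trans ?_⟩
  have h1 := ((continuous_meanInner (p := p) I w x).tendsto v).comp hv
  have h2 : Tendsto (fun k : ℕ => S - 1 / ((k : ℝ) + 1)) atTop (𝓝 S) := by
    simpa using (tendsto_one_div_add_atTop_nhds_zero_nat (𝕜 := ℝ)).const_sub S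
  exact le_of_tendsto_of_tendsto' h2 h1 fun k => (hu k).le

/-- For fixed u this is a quadratic in t with vertex at the mean inner product, so minimizing over
the cone amounts to maximizing over directions. -/
theorem sum_dist_sq_ray (I : Finset ι) {w : ι → ℝ} (hw1 : ∑ i ∈ I, w i = 1) (x : ι → Y)
    (u : SpaceOfDirections p) {t : ℝ} (ht : 0 < t) :
    ∑ i ∈ I, w i * dist (coneProj p (x i)) (TangentCone.ray u t ht) ^ 2 =
      ∑ i ∈ I, w i * dist p (x i) ^ 2 + t ^ 2 - 2 * t * meanInner p I w x u := by
  have e : t ^ 2 = ∑ i ∈ I, w i * t ^ 2 := by rw [← Finset.sum_mul, hw1, one_mul]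
  rw [e, meanInner, Finset.mul_sum, ← Finset.sum_add_distrib, ← Finset.sum_sub_distrib]
  refine Finset.sum_congr rfl fun i _ => ?_
  rw [TangentCone.dist_sq, inner_coneProj_ray, length_coneProj, TangentCone.length]
  ring

theorem sum_dist_sq_apex (I : Finset ι) (w : ι → ℝ) (x : ι → Y) :
    ∑ i ∈ I, w i * dist (coneProj p (x i)) TangentCone.apex ^ 2 =
      ∑ i ∈ I, w i * dist p (x i) ^ 2 := by
  refine Finset.sum_congr rfl fun i _ => ?_
  have : TangentCone.inner (coneProj p (x i)) TangentCone.apex = 0 := by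
    cases coneProj p (x i) <;> rfl
  rw [TangentCone.dist_sq, this, length_coneProj, TangentCone.length]
  ring

/-- Existence of barycenters in the tangent cone; the length of the barycenter is the maximum of
`0` and of the mean inner product. -/
theorem exists_barycenter {I : Finset ι} {w : ι → ℝ} (hw : ∀ i ∈ I, 0 ≤ w i)
    (hw1 : ∑ i ∈ I, w i = 1) (x : ι → Y) :
    ∃ v : TangentCone p,
      (∀ q, q ≠ v → ∑ i ∈ I, w i * dist (coneProj p (x i)) v ^ 2 <
        ∑ i ∈ I, w i * dist (coneProj p (x i)) q ^ 2) ∧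
      (∀ u, meanInner p I w x u ≤ v.length) ∧
      (0 < v.length → ∃ u, meanInner p I w x u = v.length) := by
  by_cases h : ∃ u₀, 0 < meanInner p I w x u₀
  · obtain ⟨u₀, h₀⟩ := h
    obtain ⟨u, hu⟩ := exists_forall_meanInner_le hw x h₀
    have hpos := h₀.trans_le (hu u₀)
    refine ⟨TangentCone.ray u _ hpos, fun q hq => ?_, hu, fun _ => ⟨u, rfl⟩⟩
    rw [sum_dist_sq_ray I hw1]
    cases q with
    | apex =>
      rw [sum_dist_sq_apex]
      nlinarith
    | ray u' t ht =>
      rw [sum_dist_sq_ray I hw1]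
      have h1 := hu u'
      rcases h1.lt_or_eq with h2 | h2
      · nlinarith [mul_pos ht (sub_pos.2 h2), sq_nonneg (t - meanInner p I w x u)]
      · have huu : u' = u := by
          have := dist_sq_le_of_meanInner hw x hpos hu u' u
          rw [h2, sub_self, add_zero, mul_zero] at this
          exact dist_eq_zero.1 (pow_eq_zero_iff two_ne_zero |>.1 (le_antisymm this (by positivity)))
        subst huu
        have : t - meanInner p I w x u' ≠ 0 := fun h0 => hq (by
          congr 1; linarith)
        nlinarith [pow_pos (abs_pos.2 this) 2, sq_abs (t - meanInner p I w x u')]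
  · push Not at h
    refine ⟨TangentCone.apex, fun q hq => ?_, h, fun h0 => absurd h0 (lt_irrefl _)⟩
    rw [sum_dist_sq_apex]
    cases q with
    | apex => exact absurd rfl hq
    | ray u t ht =>
      rw [sum_dist_sq_ray I hw1]
      nlinarith [mul_nonneg ht.le (neg_nonneg.2 (h u)), pow_pos ht 2]

end Barycenter

/-! ### Energies of equivariant maps -/

namespace IsRandomWalk

variable {Γ : Type*} [Group Γ] {μ : Γ → Γ → ℝ}

/-- The neighbours of `γ`. -/
noncomputable def nbhd (hμ : IsRandomWalk μ) (γ : Γ) : Finset Γ := (hμ.finite_support γ).toFinset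

theorem finsum_eq_sum_nbhd (hμ : IsRandomWalk μ) (γ : Γ) (φ : Γ → ℝ) :
    ∑ᶠ γ', μ γ γ' * φ γ' = ∑ γ' ∈ hμ.nbhd γ, μ γ γ' * φ γ' := by
  refine finsum_eq_sum_of_support_subset _ fun γ' h => ?_
  rw [nbhd, Set.Finite.coe_toFinset]
  exact left_ne_zero_of_mul h

theorem sum_nbhd (hμ : IsRandomWalk μ) (γ : Γ) : ∑ γ' ∈ hμ.nbhd γ, μ γ γ' = 1 := by
  have := hμ.finsum_eq_sum_nbhd γ fun _ => 1
  simpa [hμ.sum_eq_one] using this.symm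

theorem finsum_translate (hμ : IsRandomWalk μ) (γ : Γ) (φ : Γ → ℝ) :
    ∑ᶠ γ', μ γ γ' * φ γ' = ∑ᶠ γ', μ 1 γ' * φ (γ * γ') := by
  rw [← finsum_comp_equiv (Equiv.mulLeft γ)]
  refine finsum_congr fun γ' => ?_
  have := hμ.invariant γ 1 γ'
  rw [mul_one] at this
  rw [Equiv.coe_mulLeft, this]

theorem one_inv (hμ : IsRandomWalk μ) (γ : Γ) : μ 1 γ⁻¹ = μ 1 γ := by
  rw [hμ.symmetric, ← hμ.invariant γ, mul_inv_cancel, mul_one, hμ.symmetric, hμ.symmetric]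

theorem finsum_inv (hμ : IsRandomWalk μ) (φ : Γ → ℝ) :
    ∑ᶠ γ, μ 1 γ * φ γ⁻¹ = ∑ᶠ γ, μ 1 γ * φ γ := by
  rw [← finsum_comp_equiv (Equiv.inv Γ)]
  refine finsum_congr fun γ => ?_
  rw [Equiv.inv_apply, inv_inv, hμ.one_inv]

/-- The averaging operator of the random walk. -/
noncomputable def average (_ : IsRandomWalk μ) (φ : Γ → ℝ) (γ : Γ) : ℝ := ∑ᶠ γ', μ γ γ' * φ γ'

theorem average_mono (hμ : IsRandomWalk μ) {φ ψ : Γ → ℝ} (h : ∀ γ, φ γ ≤ ψ γ) (γ : Γ) :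
    hμ.average φ γ ≤ hμ.average ψ γ := by
  rw [average, average, hμ.finsum_eq_sum_nbhd, hμ.finsum_eq_sum_nbhd]
  exact Finset.sum_le_sum fun γ' _ => mul_le_mul_of_nonneg_left (h γ') (hμ.nonneg _ _)

theorem average_affine (hμ : IsRandomWalk μ) (φ ψ : Γ → ℝ) (a b : ℝ) (γ : Γ) :
    hμ.average (fun γ' => φ γ' + a * ψ γ' + b) γ = hμ.average φ γ + a * hμ.average ψ γ + b := by
  rw [average, average, average, hμ.finsum_eq_sum_nbhd, hμ.finsum_eq_sum_nbhd,
    hμ.finsum_eq_sum_nbhd]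
  have : b = ∑ γ' ∈ hμ.nbhd γ, μ γ γ' * b := by rw [← Finset.sum_mul, hμ.sum_nbhd, one_mul]
  conv_rhs => rw [this]
  rw [Finset.mul_sum, ← Finset.sum_add_distrib, ← Finset.sum_add_distrib]
  exact Finset.sum_congr rfl fun _ _ => by ring

theorem finite_support_nStep (hμ : IsRandomWalk μ) (n : ℕ) (γ : Γ) :
    {γ' | nStep μ n γ γ' ≠ 0}.Finite := by
  induction n generalizing γ with
  | zero =>
    refine (Set.finite_singleton γ).subset fun γ' h => ?_
    by_contra hne
    exact h (if_neg fun h' => hne h'.symm)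
  | succ n ih =>
    refine ((hμ.finite_support γ).biUnion fun γ₁ _ => ih γ₁).subset fun γ' h => ?_
    change ∑ᶠ γ₁, μ γ γ₁ * nStep μ n γ₁ γ' ≠ 0 at h
    rw [hμ.finsum_eq_sum_nbhd] at h
    obtain ⟨γ₁, -, h₁⟩ := Finset.exists_ne_zero_of_sum_ne_zero h
    exact Set.mem_biUnion (left_ne_zero_of_mul h₁) (right_ne_zero_of_mul h₁)

/-- Turns the n-step energy into an iterated average, so that one-step inequalities can be iterated.
-/
theorem finsum_nStep (hμ : IsRandomWalk μ) (n : ℕ) (φ : Γ → ℝ) (γ : Γ) :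
    ∑ᶠ γ', nStep μ n γ γ' * φ γ' = (hμ.average^[n] φ) γ := by
  induction n generalizing γ with
  | zero =>
    rw [finsum_eq_single _ γ fun γ' h => by simp [nStep, h.symm]]
    simp [nStep]
  | succ n ih =>
    rw [Function.iterate_succ_apply', average, hμ.finsum_eq_sum_nbhd]
    simp only [← ih]
    have h : ∀ γ', nStep μ (n + 1) γ γ' * φ γ' =
        ∑ γ₁ ∈ hμ.nbhd γ, μ γ γ₁ * (nStep μ n γ₁ γ' * φ γ') := fun γ' => by
      change (∑ᶠ γ₁, μ γ γ₁ * nStep μ n γ₁ γ') * φ γ' = _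
      rw [hμ.finsum_eq_sum_nbhd, Finset.sum_mul]
      exact Finset.sum_congr rfl fun _ _ => by ring
    simp only [h]
    have hfin : ∀ γ₁, (Function.support fun γ' => nStep μ n γ₁ γ' * φ γ').Finite := fun γ₁ =>
      (hμ.finite_support_nStep n γ₁).subset fun γ' h => left_ne_zero_of_mul h
    rw [finsum_sum_comm]
    · exact Finset.sum_congr rfl fun γ₁ _ => (mul_finsum _ _).symm
    · exact fun γ₁ _ => (hfin γ₁).subset fun γ' h => right_ne_zero_of_mul h

end IsRandomWalk

/-! ### Growth of squared distances along the walk -/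

section Growth

variable {Γ : Type*} [Group Γ] {μ : Γ → Γ → ℝ} {Y : Type*} [MetricSpace Y]

theorem two_mul_energy (hμ : IsRandomWalk μ) (f : Γ → Y) :
    2 * energy μ f = ∑ γ ∈ hμ.nbhd 1, μ 1 γ * dist (f 1) (f γ) ^ 2 := by
  rw [energy, hμ.finsum_eq_sum_nbhd]; ring

theorem energy_nonneg (hμ : IsRandomWalk μ) (f : Γ → Y) : 0 ≤ energy μ f := by
  have : 0 ≤ 2 * energy μ f := by
    rw [two_mul_energy hμ]
    exact Finset.sum_nonneg fun γ _ => mul_nonneg (hμ.nonneg _ _) (by positivity)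
  linarith

theorem IsEquivariant.dist_translate {ρ : Γ →* (Y ≃ᵢ Y)} {f : Γ → Y} (hf : IsEquivariant ρ f)
    (q : Y) (γ γ' : Γ) : dist q (f (γ * γ')) = dist ((ρ γ).symm q) (f γ') := by
  rw [hf, ← (ρ γ).dist_eq ((ρ γ).symm q), IsometryEquiv.apply_symm_apply]

theorem sum_dist_le_sqrt_energy (hμ : IsRandomWalk μ) (f : Γ → Y) :
    ∑ γ ∈ hμ.nbhd 1, μ 1 γ * dist (f 1) (f γ) ≤ √(2 * energy μ f) := by
  refine Real.le_sqrt_of_sq_le ?_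
  rw [two_mul_energy hμ]
  exact Real.pow_arith_mean_le_arith_mean_pow _ _ _ (fun _ _ => hμ.nonneg _ _) (hμ.sum_nbhd 1)
    (fun _ _ => dist_nonneg) 2

/-- Triangle inequality at f(γ); by equivariance the mean step length is the same at every γ, and
Jensen bounds it by √(2E). -/
theorem average_dist_le (hμ : IsRandomWalk μ) {ρ : Γ →* (Y ≃ᵢ Y)} {f : Γ → Y}
    (hf : IsEquivariant ρ f) (q : Y) (γ : Γ) :
    hμ.average (fun γ' => dist q (f γ')) γ ≤ dist q (f γ) + √(2 * energy μ f) := by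
  rw [IsRandomWalk.average, hμ.finsum_translate, hμ.finsum_eq_sum_nbhd]
  have e := hf.dist_translate q γ 1
  rw [mul_one] at e
  have h : ∑ γ' ∈ hμ.nbhd 1, μ 1 γ' * dist q (f (γ * γ')) ≤
      ∑ γ' ∈ hμ.nbhd 1, μ 1 γ' * (dist q (f γ) + dist (f 1) (f γ')) :=
    Finset.sum_le_sum fun γ' _ => mul_le_mul_of_nonneg_left
      (by rw [hf.dist_translate, e]; exact dist_triangle _ _ _) (hμ.nonneg _ _)
  simp only [mul_add, Finset.sum_add_distrib, ← Finset.sum_mul, hμ.sum_nbhd, one_mul] at h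
  linarith [sum_dist_le_sqrt_energy hμ f]

variable [CAT0Space Y]

/-- The mean squared distance of `q` to the neighbours of `f(e)` exceeds the squared distance to
`f(e)` by the energy, up to the Laplacian. -/
theorem le_sum_dist_sq (hμ : IsRandomWalk μ) (f : Γ → Y) {B : ℝ}
    (hB : ∀ u, meanInner (f 1) (hμ.nbhd 1) (μ 1) f u ≤ B) (q : Y) :
    dist q (f 1) ^ 2 + 2 * energy μ f - 2 * B * dist q (f 1) ≤
      ∑ γ ∈ hμ.nbhd 1, μ 1 γ * dist q (f γ) ^ 2 := by
  rw [two_mul_energy hμ]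
  by_cases h : f 1 = q
  · simp [← h]
  have h1 := hB (geodesicTo (f 1) q h)
  have h2 : ∑ γ ∈ hμ.nbhd 1, μ 1 γ * (dist (f 1) (f γ) ^ 2 + dist (f 1) q ^ 2 -
      2 * dist (f 1) q * dirInner (f 1) (f γ) (geodesicTo (f 1) q h)) ≤
      ∑ γ ∈ hμ.nbhd 1, μ 1 γ * dist q (f γ) ^ 2 :=
    Finset.sum_le_sum fun γ _ => mul_le_mul_of_nonneg_left
      (by rw [dist_comm q]; exact dist_sq_ge_of_dirInner (f γ) q h) (hμ.nonneg _ _)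
  have h3 : ∑ γ ∈ hμ.nbhd 1, μ 1 γ * (dist (f 1) (f γ) ^ 2 + dist (f 1) q ^ 2 -
      2 * dist (f 1) q * dirInner (f 1) (f γ) (geodesicTo (f 1) q h)) =
      ∑ γ ∈ hμ.nbhd 1, μ 1 γ * dist (f 1) (f γ) ^ 2 + dist (f 1) q ^ 2 -
        2 * dist (f 1) q * meanInner (f 1) (hμ.nbhd 1) (μ 1) f (geodesicTo (f 1) q h) := by
    have e : dist (f 1) q ^ 2 = ∑ γ ∈ hμ.nbhd 1, μ 1 γ * dist (f 1) q ^ 2 := by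
      rw [← Finset.sum_mul, hμ.sum_nbhd, one_mul]
    conv_rhs => rw [e]
    rw [meanInner, Finset.mul_sum, ← Finset.sum_add_distrib, ← Finset.sum_sub_distrib]
    exact Finset.sum_congr rfl fun _ _ => by ring
  rw [dist_comm q (f 1)]
  have := mul_le_mul_of_nonneg_left h1 (show 0 ≤ 2 * dist (f 1) q by positivity)
  linarith

theorem le_average_dist_sq (hμ : IsRandomWalk μ) {ρ : Γ →* (Y ≃ᵢ Y)} {f : Γ → Y}
    (hf : IsEquivariant ρ f) {B : ℝ}
    (hB : ∀ u, meanInner (f 1) (hμ.nbhd 1) (μ 1) f u ≤ B) (q : Y) (γ : Γ) :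
    dist q (f γ) ^ 2 + 2 * energy μ f - 2 * B * dist q (f γ) ≤
      hμ.average (fun γ' => dist q (f γ') ^ 2) γ := by
  have h := le_sum_dist_sq hμ f hB ((ρ γ).symm q)
  rw [← hf.dist_translate, mul_one] at h
  rw [IsRandomWalk.average, hμ.finsum_translate, hμ.finsum_eq_sum_nbhd]
  simpa only [hf.dist_translate] using h

/-- Each step gains 2E and loses 2B times the current distance, whose mean grows by at most √(2E)
per step. The coefficient n² is a generous bound for 0 + 1 + ⋯ + (n-1). -/
theorem le_iterate_average_dist_sq (hμ : IsRandomWalk μ) {ρ : Γ →* (Y ≃ᵢ Y)} {f : Γ → Y}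
    (hf : IsEquivariant ρ f) {B : ℝ} (hB0 : 0 ≤ B)
    (hB : ∀ u, meanInner (f 1) (hμ.nbhd 1) (μ 1) f u ≤ B) (q : Y) (n : ℕ) (γ : Γ) :
    dist q (f γ) ^ 2 + 2 * n * energy μ f -
        2 * B * (n * dist q (f γ) + n ^ 2 * √(2 * energy μ f)) ≤
      (hμ.average^[n] fun γ' => dist q (f γ') ^ 2) γ := by
  induction n generalizing γ with
  | zero => simp
  | succ n ih =>
    rw [Function.iterate_succ_apply']
    refine le_trans ?_ (hμ.average_mono ih γ)
    have e : (fun γ' => dist q (f γ') ^ 2 + 2 * n * energy μ f -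
        2 * B * (n * dist q (f γ') + n ^ 2 * √(2 * energy μ f))) = fun γ' =>
        dist q (f γ') ^ 2 + (-(2 * B * n)) * dist q (f γ') +
          (2 * n * energy μ f - 2 * B * (n ^ 2 * √(2 * energy μ f))) := by
      funext γ'; ring
    rw [e, hμ.average_affine]
    have h1 := le_average_dist_sq hμ hf hB q γ
    have h2 := mul_le_mul_of_nonneg_left (average_dist_le hμ hf q γ)
      (show 0 ≤ 2 * B * n by positivity)
    have h3 : 0 ≤ B * (n + 1) * √(2 * energy μ f) := by positivity
    push_cast
    linarith

/-- A spectral-gap type bound for the `n`-step energy bounds the Laplacian from below. -/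
theorem le_sq_of_energy_nStep_le (hμ : IsRandomWalk μ) {ρ : Γ →* (Y ≃ᵢ Y)} {f : Γ → Y}
    (hf : IsEquivariant ρ f) {B : ℝ} (hB0 : 0 ≤ B)
    (hB : ∀ u, meanInner (f 1) (hμ.nbhd 1) (μ 1) f u ≤ B) {n : ℕ} (hn : 0 < n) {ε : ℝ}
    (hε : 0 < ε) (h : energy (nStep μ n) f ≤ (n - ε) * energy μ f) :
    ε ^ 2 / (2 * n ^ 4) * energy μ f ≤ B ^ 2 := by
  have hE := energy_nonneg hμ f
  have h1 := le_iterate_average_dist_sq hμ hf hB0 hB (f 1) n 1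
  rw [← hμ.finsum_nStep] at h1
  rw [energy] at h
  rw [dist_self] at h1
  have hn' : (0 : ℝ) < n := Nat.cast_pos.2 hn
  obtain ⟨r, hr⟩ : ∃ r, r = √(2 * energy μ f) := ⟨_, rfl⟩
  have hr0 : 0 ≤ r := hr ▸ Real.sqrt_nonneg _
  have hr2 : r ^ 2 = 2 * energy μ f := by rw [hr]; exact Real.sq_sqrt (by positivity)
  rw [← hr] at h1
  have h2 : ε * r * r ≤ 2 * B * n ^ 2 * r := by nlinarith
  have h3 : ε * r ≤ 2 * B * n ^ 2 := by
    rcases hr0.eq_or_lt with h0 | h0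
    · rw [← h0, mul_zero]; positivity
    · exact le_of_mul_le_mul_right h2 h0
  have h4 := pow_le_pow_left₀ (by positivity) h3 2
  rw [div_mul_eq_mul_div, div_le_iff₀ (by positivity)]
  nlinarith

end Growth

/-- Caristi's principle: a continuous nonnegative function on a complete space which, wherever it
does not vanish, can be decreased by the distance moved, has a zero. -/
theorem exists_eq_zero_of_forall_exists_dist_le {X : Type*} [MetricSpace X] [CompleteSpace X]
    [Nonempty X] {φ : X → ℝ} (hφ : Continuous φ) (h0 : ∀ x, 0 ≤ φ x)
    (h : ∀ x, φ x ≠ 0 → ∃ y, y ≠ x ∧ dist x y ≤ φ x - φ y) : ∃ x, φ x = 0 := by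
  -- Among the points admissible from x, choose one that takes φ at least halfway down to its
  -- infimum there.
  have hstep : ∀ x, ∃ y, dist x y ≤ φ x - φ y ∧ ∀ z, dist x z ≤ φ x - φ z →
      φ y ≤ (φ x + φ z) / 2 := by
    intro x
    obtain ⟨i, hi⟩ : ∃ i, i = sInf (φ '' {y | dist x y ≤ φ x - φ y}) := ⟨_, rfl⟩
    have hbdd : BddBelow (φ '' {y | dist x y ≤ φ x - φ y}) :=
      ⟨0, by rintro _ ⟨y, -, rfl⟩; exact h0 y⟩
    have hle : ∀ z, dist x z ≤ φ x - φ z → i ≤ φ z := fun z hz =>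
      hi ▸ csInf_le hbdd ⟨z, hz, rfl⟩
    have hx : dist x x ≤ φ x - φ x := by simp
    rcases (hle x hx).eq_or_lt with heq | hlt
    · exact ⟨x, hx, fun z hz => by linarith [hle z hz]⟩
    · obtain ⟨_, ⟨y, hy, rfl⟩, hy'⟩ := exists_lt_of_csInf_lt
        (⟨φ x, x, hx, rfl⟩ : (φ '' {y | dist x y ≤ φ x - φ y}).Nonempty)
        (show sInf (φ '' {y | dist x y ≤ φ x - φ y}) < (φ x + i) / 2 by rw [← hi]; linarith)
      exact ⟨y, hy, fun z hz => by linarith [hle z hz]⟩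
  choose g hg hg' using hstep
  let x : ℕ → X := fun n => g^[n] (Classical.arbitrary X)
  have hxs : ∀ n, x (n + 1) = g (x n) := fun n => Function.iterate_succ_apply' g n _
  have hdist : ∀ m k, dist (x m) (x (m + k)) ≤ φ (x m) - φ (x (m + k)) := by
    intro m k
    induction k with
    | zero => simp
    | succ k ih =>
      have := hg (x (m + k))
      rw [← hxs] at this
      rw [← add_assoc]
      linarith [dist_triangle (x m) (x (m + k)) (x (m + k + 1))]
  have hanti : Antitone (φ ∘ x) := antitone_nat_of_succ_le fun n => by
    have := hdist n 1
    simp only [Function.comp]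
    linarith [dist_nonneg (x := x n) (y := x (n + 1))]
  have hlim : Tendsto (φ ∘ x) atTop (𝓝 (⨅ n, (φ ∘ x) n)) :=
    tendsto_atTop_ciInf hanti ⟨0, by rintro _ ⟨n, rfl⟩; exact h0 _⟩
  generalize (⨅ n, (φ ∘ x) n) = l at hlim
  have hcauchy : CauchySeq x := by
    refine cauchySeq_of_le_tendsto_0' (fun n => φ (x n) - l) (fun n m hnm => ?_) ?_
    · obtain ⟨k, rfl⟩ := Nat.exists_eq_add_of_le hnm
      have := hanti.le_of_tendsto hlim (n + k)
      simp only [Function.comp] at this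
      linarith [hdist n k]
    · simpa using hlim.sub_const l
  obtain ⟨a, ha⟩ := cauchySeq_tendsto_of_complete hcauchy
  have hφa : φ a = l := tendsto_nhds_unique ((hφ.tendsto a).comp ha) hlim
  refine ⟨a, by_contra fun hne => ?_⟩
  obtain ⟨y, hy, hya⟩ := h a hne
  have hxa : ∀ n, dist (x n) a ≤ φ (x n) - φ a := fun n => by
    refine le_of_tendsto_of_tendsto' (tendsto_const_nhds.dist (ha.comp (tendsto_add_atTop_nat n)))
      (tendsto_const_nhds.sub ((hφ.tendsto a).comp (ha.comp (tendsto_add_atTop_nat n)))) fun k => ?_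
    simpa only [Function.comp, add_comm k n] using hdist n k
  -- Admissibility is transitive, so y is admissible from every x n; in the limit φ a ≤ φ y,
  -- although y lies strictly below a.
  have hxy : ∀ n, φ (x (n + 1)) ≤ (φ (x n) + φ y) / 2 := fun n => by
    rw [hxs]
    exact hg' (x n) y (by linarith [dist_triangle (x n) a y, hxa n])
  have hl : l ≤ (l + φ y) / 2 := le_of_tendsto_of_tendsto'
    (hlim.comp (tendsto_add_atTop_nat 1)) ((hlim.add_const (φ y)).div_const 2) hxy
  linarith [dist_pos.2 hy, dist_comm a y]

/-! ### Descent of the energy and fixed points -/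

section Descent

variable {Γ : Type*} [Group Γ] {μ : Γ → Γ → ℝ} {Y : Type*} [MetricSpace Y]

/-- The energy of the equivariant map with value `p` at `e`. -/
noncomputable def orbitEnergy (μ : Γ → Γ → ℝ) (ρ : Γ →* (Y ≃ᵢ Y)) (p : Y) : ℝ :=
  energy μ fun γ => ρ γ p

theorem isEquivariant_orbit (ρ : Γ →* (Y ≃ᵢ Y)) (p : Y) : IsEquivariant ρ fun γ => ρ γ p :=
  fun γ γ' => congrArg (fun σ : Y ≃ᵢ Y => σ p) (map_mul ρ γ γ')

theorem two_mul_orbitEnergy (hμ : IsRandomWalk μ) (ρ : Γ →* (Y ≃ᵢ Y)) (p : Y) :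
    2 * orbitEnergy μ ρ p = ∑ γ ∈ hμ.nbhd 1, μ 1 γ * dist p (ρ γ p) ^ 2 := by
  have h := two_mul_energy hμ fun γ => ρ γ p
  simp only [map_one] at h
  exact h

theorem continuous_orbitEnergy (hμ : IsRandomWalk μ) (ρ : Γ →* (Y ≃ᵢ Y)) :
    Continuous (orbitEnergy μ ρ) := by
  have : orbitEnergy μ ρ = fun p => (∑ γ ∈ hμ.nbhd 1, μ 1 γ * dist p (ρ γ p) ^ 2) / 2 := by
    funext p
    linarith [two_mul_orbitEnergy hμ ρ p]
  rw [this]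
  refine (continuous_finsetSum _ fun γ _ => ?_).div_const 2
  exact continuous_const.mul ((continuous_id.dist (ρ γ).continuous).pow 2)

/-- Zero energy fixes p under the support of μ(e,·), and by invariance the increments of a chain
from e to γ lie in that support. -/
theorem isFixed_of_orbitEnergy_eq_zero (hμ : IsRandomWalk μ) (ρ : Γ →* (Y ≃ᵢ Y)) {p : Y}
    (h : orbitEnergy μ ρ p = 0) (γ : Γ) : ρ γ p = p := by
  have h1 : ∀ γ, μ 1 γ ≠ 0 → ρ γ p = p := by
    intro γ hγ
    have hsum := two_mul_orbitEnergy hμ ρ p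
    rw [h, mul_zero] at hsum
    have := (Finset.sum_eq_zero_iff_of_nonneg fun γ _ =>
      mul_nonneg (hμ.nonneg 1 γ) (sq_nonneg (dist p (ρ γ p)))).1 hsum.symm γ
      ((hμ.finite_support 1).mem_toFinset.2 hγ)
    rcases mul_eq_zero.1 this with h | h
    · exact absurd h hγ
    · exact (dist_eq_zero.1 (pow_eq_zero_iff two_ne_zero |>.1 h)).symm
  obtain ⟨n, g, hg0, hgn, hg⟩ := hμ.irreducible 1 γ
  have h2 : ∀ i ≤ n, ρ (g i) p = p := by
    intro i hi
    induction i with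
    | zero => rw [hg0, map_one]; rfl
    | succ i ih =>
      have h3 := h1 ((g i)⁻¹ * g (i + 1)) (by
        rw [← hμ.invariant (g i), mul_one, mul_inv_cancel_left]; exact hg i hi)
      calc ρ (g (i + 1)) p = ρ (g i * ((g i)⁻¹ * g (i + 1))) p := by rw [mul_inv_cancel_left]
        _ = ρ (g i) (ρ ((g i)⁻¹ * g (i + 1)) p) := by rw [map_mul]; rfl
        _ = p := by rw [h3, ih (Nat.le_of_succ_le hi)]
  exact hgn ▸ h2 n le_rfl

theorem eventually_mul_le {a b : ℝ} (hb : 0 < b) : ∀ᶠ t in 𝓝[>] (0 : ℝ), t * a ≤ b := by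
  have h : Tendsto (fun t : ℝ => t * a) (𝓝 0) (𝓝 0) := by
    simpa using (continuous_mul_const a).tendsto 0
  exact ((h.eventually (Iio_mem_nhds hb)).filter_mono nhdsWithin_le_nhds).mono fun t ht => ht.le

variable [CAT0Space Y]

/-- The isometry `σ` maps the geodesic from `p` to `σ⁻¹ p` to the reverse of the geodesic from `p`
to `σ p`. -/
theorem map_geodesicTo_symm (σ : Y ≃ᵢ Y) {p : Y} (h : p ≠ σ p) (h' : p ≠ σ.symm p) {s : ℝ}
    (hs : s ∈ Set.Icc 0 (dist p (σ p))) :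
    σ ((geodesicTo p (σ.symm p) h').toFun s) =
      (geodesicTo p (σ p) h).toFun (dist p (σ p) - s) := by
  have hd : dist p (σ.symm p) = dist (σ p) p := by
    rw [← σ.dist_eq p, σ.apply_symm_apply]
  have h1 : IsUnitSpeedGeodesic (fun s => σ ((geodesicTo p (σ.symm p) h').toFun s)) (σ p) p := by
    obtain ⟨e1, e2, e3⟩ := (CAT0Space.exists_geodesic p (σ.symm p)).choose_spec
    rw [hd] at e2 e3
    refine ⟨congrArg σ e1, ?_, fun s hs t ht => ?_⟩
    · exact (congrArg σ e2).trans (σ.apply_symm_apply p)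
    · rw [σ.dist_eq]
      exact e3 s hs t ht
  have h2 : IsUnitSpeedGeodesic (geodesicTo p (σ p) h).toFun p (σ p) :=
    (CAT0Space.exists_geodesic p (σ p)).choose_spec
  exact h1.eq_of_mem h2.reverse h.symm (by rwa [dist_comm])

/-- First variation of the squared displacement of an isometry. -/
theorem eventually_dist_map_sq_le (σ : Y ≃ᵢ Y) {p : Y} (c : NontrivialGeodesic p) {δ : ℝ}
    (hδ : 0 < δ) : ∀ᶠ t in 𝓝[>] (0 : ℝ), dist (c.toFun t) (σ (c.toFun t)) ^ 2 ≤
      dist p (σ p) ^ 2 - 2 * t * (dirInner p (σ p) c + dirInner p (σ.symm p) c - δ) := by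
  by_cases h : p = σ p
  -- When σ fixes p, the displacement of c(t) is at most 2t, and 4t² ≤ 2tδ for small t.
  · have h' : σ.symm p = p := by rw [σ.symm_apply_eq]; exact h
    rw [← h, h', dirInner_self, dist_self]
    filter_upwards [eventually_mul_le (a := 2) hδ, Ioo_mem_nhdsGT c.length_pos] with t ht ht'
    have h1 := dist_triangle (c.toFun t) p (σ (c.toFun t))
    rw [dist_comm (c.toFun t) p] at h1
    have h2 := σ.dist_eq p (c.toFun t)
    rw [← h] at h2
    rw [h2, c.dist_base ht'.1.le ht'.2.le] at h1
    have h3 := pow_le_pow_left₀ dist_nonneg h1 2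
    nlinarith [ht'.1]
  have h' : p ≠ σ.symm p := fun e => h (by rw [← σ.symm_apply_eq]; exact e.symm)
  have hL := dist_pos.2 h
  have hL' : dist p (σ.symm p) = dist p (σ p) := by
    rw [← σ.dist_eq p, σ.apply_symm_apply, dist_comm]
  -- Squaring the displacement turns the two errors tδ' into tδ in total; another tδ is left for the
  -- second-order term.
  obtain ⟨δ', hδ'⟩ : ∃ δ', δ' = δ / (4 * dist p (σ p)) := ⟨_, rfl⟩
  have hδ'0 : 0 < δ' := by rw [hδ']; positivity
  have hδL : 4 * dist p (σ p) * δ' = δ := by rw [hδ']; field_simp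
  obtain ⟨η₁, hη₁, H₁⟩ := c.exists_dist_le (geodesicTo p (σ p) h) hδ'0
  obtain ⟨η₂, hη₂, H₂⟩ := c.exists_dist_le (geodesicTo p (σ.symm p) h') hδ'0
  obtain ⟨s, hs, hs'⟩ := exists_between (show 0 < min (min η₁ η₂) (dist p (σ p) / 2) by positivity)
  simp only [lt_min_iff] at hs'
  rw [dirInner_coe_of_ne h, dirInner_coe_of_ne h', hL',
    NontrivialGeodesic.angle_comm _ c, NontrivialGeodesic.angle_comm _ c]
  generalize Real.cos (c.angle (geodesicTo p (σ p) h)) = k₁ at *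
  generalize Real.cos (c.angle (geodesicTo p (σ.symm p) h')) = k₂ at *
  filter_upwards [H₁ s hs hs'.1.1, H₂ s hs hs'.1.2, self_mem_nhdsWithin,
    eventually_mul_le (a := (k₁ + k₂ - 2 * δ') ^ 2) hδ] with t h1 h2 ht0 ht
  have ht0 : 0 < t := ht0
  have hgeo : dist ((geodesicTo p (σ p) h).toFun s)
      ((geodesicTo p (σ p) h).toFun (dist p (σ p) - s)) = dist p (σ p) - 2 * s := by
    have := (geodesicTo p (σ p) h).dist_eq s ⟨hs.le, by simp only [geodesicTo]; linarith⟩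
      (dist p (σ p) - s) ⟨by linarith, by simp only [geodesicTo]; linarith⟩
    rw [this, abs_of_neg (by linarith)]
    ring
  -- The path runs through the geodesic from p to σ p at distance s from each end. Applying σ⁻¹ to
  -- its last leg gives a first variation towards σ⁻¹ p.
  have h3 : dist (c.toFun t) (σ (c.toFun t)) ≤ dist p (σ p) - t * (k₁ + k₂ - 2 * δ') := by
    have t1 := dist_triangle4 (c.toFun t) ((geodesicTo p (σ p) h).toFun s)
      ((geodesicTo p (σ p) h).toFun (dist p (σ p) - s)) (σ (c.toFun t))
    rw [hgeo, ← map_geodesicTo_symm σ h h' ⟨hs.le, by linarith⟩, σ.dist_eq,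
      dist_comm _ (c.toFun t)] at t1
    linarith
  have h4 := pow_le_pow_left₀ dist_nonneg h3 2
  have h5 := mul_le_mul_of_nonneg_left ht ht0.le
  refine h4.trans ?_
  have : (dist p (σ p) - t * (k₁ + k₂ - 2 * δ')) ^ 2 = dist p (σ p) ^ 2 -
      2 * t * (dist p (σ p) * k₁ + dist p (σ p) * k₂) + t * (4 * dist p (σ p) * δ') +
      t * (t * (k₁ + k₂ - 2 * δ') ^ 2) := by ring
  rw [this, hδL]
  linarith

/-- Both endpoints of each displacement move, contributing inner products towards ρ(γ)p and ρ(γ)⁻¹p.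
Since μ(e,γ) = μ(e,γ⁻¹), the two sums agree, hence the factor 2. -/
theorem eventually_orbitEnergy_le (hμ : IsRandomWalk μ) (ρ : Γ →* (Y ≃ᵢ Y)) {p : Y}
    (c : NontrivialGeodesic p) {δ : ℝ} (hδ : 0 < δ) : ∀ᶠ t in 𝓝[>] (0 : ℝ),
      orbitEnergy μ ρ (c.toFun t) ≤ orbitEnergy μ ρ p -
        t * (2 * meanInner p (hμ.nbhd 1) (μ 1) (fun γ => ρ γ p) c - δ) := by
  have hev : ∀ᶠ t in 𝓝[>] (0 : ℝ), ∀ γ ∈ hμ.nbhd 1, dist (c.toFun t) (ρ γ (c.toFun t)) ^ 2 ≤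
      dist p (ρ γ p) ^ 2 - 2 * t * (dirInner p (ρ γ p) c + dirInner p ((ρ γ).symm p) c - δ) :=
    (Finset.eventually_all _).2 fun γ _ => eventually_dist_map_sq_le (ρ γ) c hδ
  filter_upwards [hev] with t ht
  have hsymm : ∑ γ ∈ hμ.nbhd 1, μ 1 γ * dirInner p ((ρ γ).symm p) c =
      meanInner p (hμ.nbhd 1) (μ 1) (fun γ => ρ γ p) c := by
    have := hμ.finsum_inv fun γ => dirInner p (ρ γ p) c
    rw [hμ.finsum_eq_sum_nbhd, hμ.finsum_eq_sum_nbhd] at this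
    rw [meanInner, ← this]
    exact Finset.sum_congr rfl fun γ _ => by rw [map_inv]; rfl
  have hsum := Finset.sum_le_sum fun γ hγ => mul_le_mul_of_nonneg_left (ht γ hγ) (hμ.nonneg 1 γ)
  rw [← two_mul_orbitEnergy] at hsum
  have e : ∑ γ ∈ hμ.nbhd 1, μ 1 γ * (dist p (ρ γ p) ^ 2 -
      2 * t * (dirInner p (ρ γ p) c + dirInner p ((ρ γ).symm p) c - δ)) =
      2 * orbitEnergy μ ρ p -
        2 * t * (2 * meanInner p (hμ.nbhd 1) (μ 1) (fun γ => ρ γ p) c - δ) := by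
    have eδ : δ = ∑ γ ∈ hμ.nbhd 1, μ 1 γ * δ := by rw [← Finset.sum_mul, hμ.sum_nbhd, one_mul]
    rw [two_mul (meanInner _ _ _ _ _)]
    nth_rw 2 [← hsymm]
    conv_rhs => rw [eδ]
    rw [two_mul_orbitEnergy hμ, meanInner, ← Finset.sum_add_distrib, ← Finset.sum_sub_distrib,
      Finset.mul_sum, ← Finset.sum_sub_distrib]
    exact Finset.sum_congr rfl fun _ _ => by ring
  rw [e] at hsum
  linarith

/-- A lower bound for the Laplacian in terms of the energy forces a fixed point. -/
theorem exists_fixedPoint [CompleteSpace Y] [Nonempty Y] (hμ : IsRandomWalk μ)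
    (ρ : Γ →* (Y ≃ᵢ Y)) {C : ℝ} (hC : 0 < C)
    (h : ∀ p, 0 < orbitEnergy μ ρ p → ∃ u, C * orbitEnergy μ ρ p ≤
      meanInner p (hμ.nbhd 1) (μ 1) (fun γ => ρ γ p) u ^ 2 ∧
      0 < meanInner p (hμ.nbhd 1) (μ 1) (fun γ => ρ γ p) u) :
    ∃ p : Y, ∀ γ : Γ, ρ γ p = p := by
  have hE : ∀ p, 0 ≤ orbitEnergy μ ρ p := fun p => energy_nonneg hμ _
  have hκ : 0 < √C := Real.sqrt_pos.2 hC
  obtain ⟨p, hp⟩ := exists_eq_zero_of_forall_exists_dist_le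
    -- The factor makes φ drop by at least the distance moved when √E falls at rate √C/2.
    (φ := fun p => 2 / √C * √(orbitEnergy μ ρ p))
    (continuous_const.mul (continuous_orbitEnergy hμ ρ).sqrt) (fun p => by positivity) (by
      intro p hp
      have hEp : 0 < orbitEnergy μ ρ p := (hE p).lt_of_ne fun h0 => hp (by simp [← h0])
      obtain ⟨u, hu, hu0⟩ := h p hEp
      obtain ⟨B, hB⟩ : ∃ B, B = meanInner p (hμ.nbhd 1) (μ 1) (fun γ => ρ γ p) u := ⟨_, rfl⟩
      rw [← hB] at hu hu0
      -- The direction u may exist only in the completion; a nearby genuine geodesic keeps 3/4 of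
      -- its value, and then 2·(3/4)B - B/2 = B is the rate of descent.
      obtain ⟨c, hc⟩ : ∃ c : NontrivialGeodesic p,
          3 / 4 * B < meanInner p (hμ.nbhd 1) (μ 1) (fun γ => ρ γ p) c := by
        have hopen : IsOpen {u | 3 / 4 * B < meanInner p (hμ.nbhd 1) (μ 1) (fun γ => ρ γ p) u} :=
          isOpen_lt continuous_const (continuous_meanInner _ _ _)
        exact UniformSpace.Completion.denseRange_coe.exists_mem_open hopen
          ⟨u, by rw [Set.mem_ofPred_eq, ← hB]; linarith⟩
      obtain ⟨t, ht, ht'⟩ := ((eventually_orbitEnergy_le hμ ρ c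
        (show 0 < B / 2 by positivity)).and (Ioo_mem_nhdsGT c.length_pos)).exists
      refine ⟨c.toFun t, (c.ne_base ht'.1 ht'.2.le).symm, ?_⟩
      rw [c.dist_base ht'.1.le ht'.2.le]
      have ht0 : 0 < t := ht'.1
      have h1 : orbitEnergy μ ρ (c.toFun t) ≤ orbitEnergy μ ρ p - t * B := by nlinarith
      have hB2 : √C * √(orbitEnergy μ ρ p) ≤ B := by
        rw [← Real.sqrt_mul hC.le]
        exact Real.sqrt_le_iff.2 ⟨hu0.le, hu⟩
      have e1 := Real.sq_sqrt (hE p)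
      have e2 := Real.sq_sqrt (hE (c.toFun t))
      have hr := Real.sqrt_pos.2 hEp
      have hr' : √(orbitEnergy μ ρ (c.toFun t)) ≤ √(orbitEnergy μ ρ p) :=
        Real.sqrt_le_sqrt (h1.trans (by linarith [mul_pos ht0 hu0]))
      have hr'0 := Real.sqrt_nonneg (orbitEnergy μ ρ (c.toFun t))
      generalize √(orbitEnergy μ ρ (c.toFun t)) = r' at *
      generalize √(orbitEnergy μ ρ p) = r at *
      -- Combines r² - r'² ≥ tB ≥ t√C·r with r² - r'² ≤ 2r(r - r').
      have h2 : r * (t * √C) ≤ r * (2 * (r - r')) := by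
        nlinarith [mul_le_mul_of_nonneg_left hB2 ht0.le]
      have h3 := le_of_mul_le_mul_left h2 hr
      have h4 : 2 / √C * r - 2 / √C * r' = 2 * (r - r') / √C := by ring
      rw [h4, le_div_iff₀ hκ]
      exact h3)
  refine ⟨p, isFixed_of_orbitEnergy_eq_zero hμ ρ ?_⟩
  rcases mul_eq_zero.1 hp with h0 | h0
  · exact absurd h0 (by positivity)
  · exact (Real.sqrt_eq_zero (hE p)).1 h0

end Descent

/-! ### The main theorem -/

theorem mainTheorem3 {Γ : Type*} [Group Γ] [Group.FG Γ]
    {Y : Type*} [MetricSpace Y] [CompleteSpace Y] [Nonempty Y] [CAT0Space Y]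
    (μ : Γ → Γ → ℝ) (hμ : IsRandomWalk μ) (ρ : Γ →* (Y ≃ᵢ Y))
    (h : ∃ n : ℕ, 0 < n ∧ ∃ ε : ℝ, 0 < ε ∧ ∀ f : Γ → Y, IsEquivariant ρ f →
      energy (nStep μ n) f ≤ ((n : ℝ) - ε) * energy μ f) :
    (∃ C : ℝ, 0 < C ∧ ∀ f : Γ → Y, IsEquivariant ρ f →
      ∃ v : TangentCone (f 1), IsNegLaplacian μ f v ∧ v.length ^ 2 ≥ C * energy μ f) ∧
    ∃ p : Y, ∀ γ : Γ, ρ γ p = p := by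
  obtain ⟨n, hn, ε, hε, h⟩ := h
  have hC : (0 : ℝ) < ε ^ 2 / (2 * n ^ 4) := by
    have : (0 : ℝ) < n := Nat.cast_pos.2 hn
    positivity
  have hbary := fun f : Γ → Y => exists_barycenter (p := f 1) (I := hμ.nbhd 1)
    (fun γ _ => hμ.nonneg 1 γ) (hμ.sum_nbhd 1) f
  refine ⟨⟨_, hC, fun f hf => ?_⟩, exists_fixedPoint hμ ρ hC fun p hp => ?_⟩
  · obtain ⟨v, hv, hle, -⟩ := hbary f
    refine ⟨v, fun q hq => ?_,
      le_sq_of_energy_nStep_le hμ hf v.length_nonneg hle hn hε (h f hf)⟩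
    rw [hμ.finsum_eq_sum_nbhd, hμ.finsum_eq_sum_nbhd]
    exact hv q hq
  · have hf := isEquivariant_orbit ρ p
    obtain ⟨v, -, hle, hmax⟩ := hbary fun γ => ρ γ p
    have hsq := le_sq_of_energy_nStep_le hμ hf v.length_nonneg hle hn hε (h _ hf)
    have hv : 0 < v.length := by
      refine v.length_nonneg.lt_of_ne fun h0 => ?_
      rw [← h0] at hsq
      have := mul_pos hC hp
      rw [orbitEnergy] at this
      linarith
    obtain ⟨u, hu⟩ := hmax hv
    rw [← hu] at hsq hv
    -- The direction u is based at ρ(e)p, which equals p only propositionally; generalizing over u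
    -- permits the change of base point.
    have hp1 : ρ 1 p = p := by rw [map_one]; rfl
    clear hu hmax hle
    revert u
    rw [hp1]
    exact fun u hv hsq => ⟨u, hsq, hv⟩
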